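/- **Theorem.** Let $(M,g)$ be a smooth 5-dimensional Riemannian manifold with an $\mathbf{SO}(3)$ structure $\Upsilon$, i.e. a smooth rank 3 tensor field such that the associated maps $v\mapsto\Upsilon_v\in\operatorname{End}(TM)$, $(\Upsilon_v)_{ij}=\Upsilon_{ijk}v_k$ (in orthonormal frames), are totally symmetric, $g(u,\Upsilon_v w)=g(w,\Upsilon_v u)=g(u,\Upsilon_w v)$, trace free, $\operatorname{tr}\Upsilon_v=0$, and satisfy $\Upsilon_v^2v=g(v,v)v$. For $x\in M$ let $\mathfrak{so}(3)_x\subset\mathfrak{so}(T_xM)$ be the Lie algebra of the stabiliser of $\Upsilon_x$ in $\mathbf{O}(T_xM)$. A characteristic connection of $(M,g,\Upsilon)$ is a smooth $\mathfrak{so}(3)$ connection on $TM$ (that is, a metric connection $\nabla$ with $\nabla\Upsilon=0$) whose torsion $T(u,v,w)=g(T(u,v),w)$ is totally skew-symmetric. The structure is called nearly integrable if $(\nabla^{LC}_v\Upsilon)(v,v,v)=0$ for all $v\in TM$, where $\nabla^{LC}$ is the Levi-Civita connection of $g$. 1. $(M,g,\Upsilon)$ admits a characteristic connection if and only if it is nearly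 integrable. 2. A characteristic connection, if it exists, is unique. 3. At every point $x\in M$, with $V=T_xM$, the linear map $\Upsilon':\Lambda^2V\otimes V\to\bigodot^4V$, $\Upsilon'(A)_{ijkl}=12\,A_{m(ji}\Upsilon_{kl)m}$ (indices with respect to an orthonormal basis, summation over $m$, symmetrisation over $i,j,k,l$; $A_{ijk}=-A_{jik}$), satisfies $$\ker\Upsilon'=[\mathfrak{so}(3)_x\otimes V]\oplus\Lambda^3V .$$ -/

import Mathlib

open Bundle
open scoped Manifold ContDiff

noncomputable section

namespace SO3Geometry

/-! ### Linear algebra of a tangent space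

`V` is a real vector space, `g` a scalar product on it and `Υ` a tensor of rank 3, given through its
associated linear map `v ↦ Υ_v ∈ End V`; thus `Υ v w` is `Υ_v w`, and the trilinear form
`(u, w, v) ↦ g (u, Υ_v w)` is obtained by lowering an index with `g`. -/

section Algebra

variable {V : Type*} [AddCommGroup V] [Module ℝ V] [TopologicalSpace V]
  [IsTopologicalAddGroup V] [ContinuousSMul ℝ V]

/-- The trilinear form `Υ (u, w, v) = Υ_{ijk} u_i w_j v_k` of `Υ`, where
`(Υ_v)_{ij} = Υ_{ijk} v_k`. -/
def form (g : V →L[ℝ] V →L[ℝ] ℝ) (Υ : V →L[ℝ] V →L[ℝ] V) (u w v : V) : ℝ :=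
  g u (Υ v w)

/-- `Υ` defines an `SO(3)` structure on the Euclidean space `(V, g)`: it is totally symmetric,
trace free, and `Υ_v² v = g (v, v) v`. -/
structure IsSO3Tensor (g : V →L[ℝ] V →L[ℝ] ℝ) (Υ : V →L[ℝ] V →L[ℝ] V) : Prop where
  symm_left : ∀ u v w : V, g u (Υ v w) = g w (Υ v u)
  symm_right : ∀ u v w : V, g u (Υ v w) = g u (Υ w v)
  trace_free : ∀ v : V, LinearMap.trace ℝ V (Υ v : V →ₗ[ℝ] V) = 0
  sq_apply : ∀ v : V, Υ v (Υ v v) = g v v • v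

/-- The Lie algebra `so(3)`, i.e. the Lie algebra of the stabiliser of `Υ` in the orthogonal group:
the `g`-skew endomorphisms `X` with
`Υ (X u, v, w) + Υ (u, X v, w) + Υ (u, v, X w) = 0`. -/
def so3 (g : V →L[ℝ] V →L[ℝ] ℝ) (Υ : V →L[ℝ] V →L[ℝ] V) : Submodule ℝ (V →ₗ[ℝ] V) where
  carrier := {X | (∀ u v, g (X u) v = -g u (X v)) ∧
    ∀ u v w, form g Υ (X u) v w + form g Υ u (X v) w + form g Υ u v (X w) = 0}
  zero_mem' := by simp [form]
  add_mem' := by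
    rintro X Y ⟨hX, hX'⟩ ⟨hY, hY'⟩
    refine ⟨fun u v => ?_, fun u v w => ?_⟩
    · simp only [LinearMap.add_apply, map_add, add_apply, hX, hY]
      ring
    · have h1 := hX' u v w
      have h2 := hY' u v w
      simp only [form, LinearMap.add_apply, map_add, add_apply] at h1 h2 ⊢
      linear_combination h1 + h2
  smul_mem' := by
    rintro c X ⟨hX, hX'⟩
    refine ⟨fun u v => ?_, fun u v w => ?_⟩
    · simp only [LinearMap.smul_apply, map_smul, smul_apply, hX, smul_neg]
    · have h1 := hX' u v w
      simp only [form, LinearMap.smul_apply, map_smul, smul_apply, smul_eq_mul] at h1 ⊢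
      linear_combination c * h1

variable (V) in
/-- `Λ²V ⊗ V`: the tensors `A_{ijk}` skew-symmetric in the first two indices. -/
def lambdaTwoTensor : Submodule ℝ (V →ₗ[ℝ] V →ₗ[ℝ] V →ₗ[ℝ] ℝ) where
  carrier := {A | ∀ u v a, A u v a = -A v u a}
  zero_mem' := by simp
  add_mem' := by
    intro A B hA hB u v a
    simp only [LinearMap.add_apply, hA u v a, hB u v a]
    ring
  smul_mem' := by
    intro c A hA u v a
    simp only [LinearMap.smul_apply, hA u v a, smul_neg]

/-- The subspace `so(3) ⊗ V` of `Λ²V ⊗ V`: for every `a`, the endomorphism with matrix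
`A_{ijk} a_k` lies in `so(3)`. -/
def so3Tensor (g : V →L[ℝ] V →L[ℝ] ℝ) (Υ : V →L[ℝ] V →L[ℝ] V) :
    Submodule ℝ (lambdaTwoTensor V) where
  carrier := {A | ∀ a, ∃ X ∈ so3 g Υ, ∀ u v, A.1 u v a = g u (X v)}
  zero_mem' := fun _ => ⟨0, zero_mem _, by simp⟩
  add_mem' := by
    intro A B hA hB a
    obtain ⟨X, hX, hX'⟩ := hA a
    obtain ⟨Y, hY, hY'⟩ := hB a
    exact ⟨X + Y, add_mem hX hY, fun u v => by simp [hX', hY']⟩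
  smul_mem' := by
    intro c A hA a
    obtain ⟨X, hX, hX'⟩ := hA a
    exact ⟨c • X, Submodule.smul_mem _ c hX, fun u v => by simp [hX']⟩

variable (V) in
/-- The subspace `Λ³V` of `Λ²V ⊗ V`: the totally skew-symmetric tensors. -/
def lambdaThree : Submodule ℝ (lambdaTwoTensor V) where
  carrier := {A | ∀ u v a, A.1 u v a = -A.1 u a v}
  zero_mem' := by simp
  add_mem' := by
    intro A B hA hB u v a
    simp only [Submodule.coe_add, LinearMap.add_apply, hA u v a, hB u v a]
    ring
  smul_mem' := by
    intro c A hA u v a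
    simp only [Submodule.coe_smul, LinearMap.smul_apply, hA u v a, smul_neg]

/-- The map `Υ' : Λ²V ⊗ V → ⊙⁴V`, `Υ'(A)_{ijkl} = 12 A_{m(ji} Υ_{kl)m}`, with values written as
functions of four vectors `i, j, k, l`. By symmetry of `Υ`, the contraction
`A_{mpq} Υ_{mrs}` is `A (Υ_r s, p, q)`; there is one summand for every ordered pair `(p, q)` of
distinct letters among `i, j, k, l`. -/
def upsilonPrime (Υ : V →L[ℝ] V →L[ℝ] V) :
    lambdaTwoTensor V →ₗ[ℝ] (V → V → V → V → ℝ) where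
  toFun A := fun i j k l =>
    (A.1 (Υ k l) j i + A.1 (Υ j l) k i + A.1 (Υ j k) l i) +
    (A.1 (Υ k l) i j + A.1 (Υ i l) k j + A.1 (Υ i k) l j) +
    (A.1 (Υ j l) i k + A.1 (Υ i l) j k + A.1 (Υ i j) l k) +
    (A.1 (Υ j k) i l + A.1 (Υ i k) j l + A.1 (Υ i j) k l)
  map_add' := by
    intro A B
    funext i j k l
    simp only [Submodule.coe_add, LinearMap.add_apply, Pi.add_apply]
    ring
  map_smul' := by
    intro c A
    funext i j k l
    simp only [Submodule.coe_smul, LinearMap.smul_apply, Pi.smul_apply, smul_eq_mul,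
      RingHom.id_apply]
    ring

end Algebra

/-! ### `SO(3)` structures on manifolds and their connections

`M` is a smooth manifold modelled on `E` (of dimension 5 in the theorem) and `g` a smooth
Riemannian metric on it. -/

section Manifold

variable {E : Type*} [NormedAddCommGroup E] [NormedSpace ℝ E]
  {H : Type*} [TopologicalSpace H] {I : ModelWithCorners ℝ E H}
  {M : Type*} [TopologicalSpace M] [ChartedSpace H M] [IsManifold I ∞ M]

/-- An `SO(3)` structure on the Riemannian manifold `(M, g)`: a smooth tensor field `Υ` satisfying
the algebraic conditions at every point. -/
structure SO3Structure (g : ContMDiffRiemannianMetric I ∞ E (TangentSpace I : M → Type _)) where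
  /-- The tensor field, as `v ↦ Υ_v ∈ End (T_x M)`. -/
  tensor : ∀ x : M, TangentSpace I x →L[ℝ] TangentSpace I x →L[ℝ] TangentSpace I x
  contMDiff_tensor : ContMDiff I (I.prod 𝓘(ℝ, E →L[ℝ] E →L[ℝ] E)) ∞
    (fun x => TotalSpace.mk' (E →L[ℝ] E →L[ℝ] E)
      (E := fun x : M => TangentSpace I x →L[ℝ] TangentSpace I x →L[ℝ] TangentSpace I x)
      x (tensor x))
  isSO3Tensor : ∀ x, IsSO3Tensor (g.inner x) (tensor x)

variable (I M) in
/-- Affine connections on `M`, as covariant derivatives: `D Y x v` is `(D_v Y)(x)`. -/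
abbrev Connection := CovariantDerivative I E (TangentSpace I : M → Type _)

/-- The torsion tensor `T(X, Y) = D_X Y - D_Y X - [X, Y]`. -/
def torsion [FiniteDimensional ℝ E] (D : Connection I M) (x : M) :
    TangentSpace I x →L[ℝ] TangentSpace I x →L[ℝ] TangentSpace I x :=
  haveI : CompleteSpace E := FiniteDimensional.complete ℝ E
  D.torsion x

variable (g : ContMDiffRiemannianMetric I ∞ E (TangentSpace I : M → Type _))

/-- `D` is metric: `v (g(X, Y)) = g(D_v X, Y) + g(X, D_v Y)`. -/
def IsMetric (D : Connection I M) : Prop :=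
  ∀ (X Y : ∀ x : M, TangentSpace I x) (x : M) (v : TangentSpace I x),
    MDiffAt (T% X) x → MDiffAt (T% Y) x →
      d% (fun y => g.inner y (X y) (Y y)) x v =
        g.inner x (D X x v) (Y x) + g.inner x (X x) (D Y x v)

/-- The Levi-Civita connection of `g`: smooth, metric and torsion-free. -/
structure IsLeviCivita [FiniteDimensional ℝ E] (D : Connection I M) : Prop where
  smooth : CovariantDerivative.ContMDiffCovariantDerivative D ∞
  metric : IsMetric g D
  torsion_free : ∀ x, torsion D x = 0

variable {g}

/-- The covariant derivative of the tensor field `Υ`, evaluated on vector fields: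
`(D_v Υ)(X, Y, Z) = v (Υ(X, Y, Z)) - Υ(D_v X, Y, Z) - Υ(X, D_v Y, Z) - Υ(X, Y, D_v Z)`. -/
def SO3Structure.tensorDeriv (S : SO3Structure g) (D : Connection I M)
    (X Y Z : ∀ x : M, TangentSpace I x) (x : M) (v : TangentSpace I x) : ℝ :=
  d% (fun y => form (g.inner y) (S.tensor y) (X y) (Y y) (Z y)) x v
    - form (g.inner x) (S.tensor x) (D X x v) (Y x) (Z x)
    - form (g.inner x) (S.tensor x) (X x) (D Y x v) (Z x)
    - form (g.inner x) (S.tensor x) (X x) (Y x) (D Z x v)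

/-- Near integrability: `(D_v Υ)(v, v, v) = 0` for all tangent vectors `v`, where `D` is the
Levi-Civita connection. -/
def SO3Structure.IsNearlyIntegrable [FiniteDimensional ℝ E] (S : SO3Structure g) : Prop :=
  ∃ D : Connection I M, IsLeviCivita g D ∧
    ∀ (X : ∀ x : M, TangentSpace I x) (x : M), MDiffAt (T% X) x →
      S.tensorDeriv D X X X x (X x) = 0

/-- An `so(3)` connection of the structure: a smooth connection with values in the Lie algebra of
the common stabiliser of `g` and `Υ`, that is, a metric connection for which `Υ` is parallel. -/
structure SO3Structure.IsSO3Connection (S : SO3Structure g) (D : Connection I M) : Prop where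
  smooth : CovariantDerivative.ContMDiffCovariantDerivative D ∞
  metric : IsMetric g D
  parallel : ∀ (X Y Z : ∀ x : M, TangentSpace I x) (x : M) (v : TangentSpace I x),
    MDiffAt (T% X) x → MDiffAt (T% Y) x → MDiffAt (T% Z) x → S.tensorDeriv D X Y Z x v = 0

/-- A characteristic connection: an `so(3)` connection whose torsion
`T(u, v, w) = g(T(u, v), w)` is totally skew-symmetric. -/
structure SO3Structure.IsCharacteristic [FiniteDimensional ℝ E] (S : SO3Structure g)
    (D : Connection I M) : Prop where
  isSO3Connection : S.IsSO3Connection D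
  torsion_swap_left : ∀ (x : M) (u v w : TangentSpace I x),
    g.inner x (torsion D x u v) w = -g.inner x (torsion D x v u) w
  torsion_swap_right : ∀ (x : M) (u v w : TangentSpace I x),
    g.inner x (torsion D x u v) w = -g.inner x (torsion D x u w) v

end Manifold

end SO3Geometry

end

/-!
The theorem rests on pointwise algebra in a Euclidean space `V` of dimension five, with the
commutative product `v w = Υ_v w`, and on a smoothness criterion that globalises it.

*Normal form.* Polarised, `Υ_v² v = g (v, v) v` says that the subalgebra generated by a vector is
at most two-dimensional, and solving a real cubic there gives an idempotent `e`
(`IsSO3Tensor.exists_idempotent`). The identity also gives the quadratic equation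
`2 L² + L = 1 + 2 g (e, ·) e` for `L = Υ_e`, so that `L` is `-1` on a subspace `Q` and `1/2` on a
subspace `P` of the complement of `e`, and `tr L = 0` makes both of them planes
(`IsSO3Tensor.finrank_eigenspace`). Finally `Q` acts on `P` by the Clifford relations, which leaves
no freedom: every `Υ` has the same multiplication table in a suitable orthogonal basis
(`IsSO3Tensor.exists_isAdapted`).

*The kernel of `Υ'`.* Both summands lie in the kernel for any symmetric `Υ` (`sup_le_ker`): on
`so(3) ⊗ V` the value of `Υ'` is a sum of derivatives of the cubic form of `Υ` along its
stabiliser, and on `Λ³V` its terms cancel in pairs. In an adapted basis, `so(3)` is cut out of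
`so(5)` by seven linear equations (`IsAdapted.mem_so3_iff`). Imposed on a totally skew tensor they
leave only zero (`IsAdapted.disjoint`), and for `A` in the kernel of `Υ'` one can subtract a totally
skew tensor such that the remainder satisfies them (`IsAdapted.ker_le`).

*Existence.* Let `∇` be the Levi-Civita connection. Differentiating the algebraic identities,
`∇_w Υ` is an infinitesimal deformation of `Υ` preserving them, hence the action of a skew
endomorphism `X_w` (`IsAdapted.exists_skew_of_deformation`). Near integrability says that the tensor
`X ∈ Λ²V ⊗ V` lies in the kernel of `Υ'`: up to a nonzero factor, `(∇_v Υ)(v, v, v)` is the quartic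
form of `Υ' (X)`. Splitting `X` accordingly, its part in `so(3) ⊗ V` does not act on `Υ`, and its
part in `Λ³V` is a totally skew correction of `∇` that makes `Υ` parallel
(`IsAdapted.exists_correction`).

*Uniqueness and the converse.* Two metric connections for which `Υ` is parallel differ by a tensor
with values in `so(3)`; if both have totally skew torsion, the difference is totally skew
(`skew_of_torsion_skew`), so it vanishes (`IsSO3Tensor.eq_zero_of_skew`). Conversely, if `D` is
characteristic with torsion `T`, then `D + T / 2` is the Levi-Civita connection, and it agrees with
`D` on the diagonal, because `T (v, v) = 0`.

*Smoothness.* A section of a vector bundle is smooth as soon as it solves, at each point, an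
injective system of linear equations with smooth coefficients
(`contMDiffAt_section_of_functionals`). This applies to the torsion of a smooth connection
(`contMDiff_torsion`) and, because `[so(3) ⊗ V] ∩ Λ³V = 0`, to the correction of `∇`
(`SO3Structure.contMDiff_correction`).
-/

noncomputable section

namespace SO3Geometry

/-! ### The commutative product `v w = Υ_v w` -/

section PointwiseAlgebra

variable {V : Type*} [AddCommGroup V] [Module ℝ V] [TopologicalSpace V]
  {g : V →L[ℝ] V →L[ℝ] ℝ}

lemma eq_of_forall_inner_eq (hpos : ∀ v, v ≠ 0 → 0 < g v v) {u v : V}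
    (h : ∀ w, g w u = g w v) : u = v := by
  by_contra hne
  have h1 := hpos (u - v) (sub_ne_zero.2 hne)
  have h2 := h (u - v)
  rw [map_sub (g (u - v))] at h1
  linarith

/-- A vector is determined by its scalar products with a basis. -/
lemma eq_of_forall_inner_basis_eq {ι : Type*} [Fintype ι] (hpos : ∀ v, v ≠ 0 → 0 < g v v)
    (b : Module.Basis ι ℝ V) {u v : V} (h : ∀ i, g (b i) u = g (b i) v) : u = v :=
  eq_of_forall_inner_eq hpos fun w => by
    rw [← b.sum_repr w]
    simp only [map_sum, map_smul, sum_apply, smul_apply, h]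

/-- Rescaling a nonzero vector to a prescribed positive square length. -/
lemma exists_smul_inner_self_eq (hpos : ∀ v, v ≠ 0 → 0 < g v v) {v : V} (hv : v ≠ 0) {r : ℝ}
    (hr : 0 < r) : ∃ c : ℝ, g (c • v) (c • v) = r := by
  have := hpos v hv
  refine ⟨√(r / g v v), ?_⟩
  simp only [map_smul, smul_apply, smul_eq_mul]
  rw [← mul_assoc, Real.mul_self_sqrt (by positivity)]
  field_simp

variable [IsTopologicalAddGroup V] [ContinuousSMul ℝ V] {Υ : V →L[ℝ] V →L[ℝ] V}

namespace IsSO3Tensor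

lemma comm (h : IsSO3Tensor g Υ) (hpos : ∀ v, v ≠ 0 → 0 < g v v) (u v : V) :
    Υ u v = Υ v u :=
  eq_of_forall_inner_eq hpos fun w => h.symm_right w u v

/-- The full polarisation of `Υ_v² v = g (v, v) v`. -/
lemma polarized (h : IsSO3Tensor g Υ) (hsymm : ∀ u v, g u v = g v u)
    (hpos : ∀ v, v ≠ 0 → 0 < g v v) (u v w : V) :
    Υ u (Υ v w) + Υ v (Υ u w) + Υ w (Υ u v) = g u v • w + g v w • u + g u w • v := by
  have e1 := h.sq_apply (u + v + w)
  have e2 := h.sq_apply (u + v)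
  have e3 := h.sq_apply (u + w)
  have e4 := h.sq_apply (v + w)
  have e5 := h.sq_apply u
  have e6 := h.sq_apply v
  have e7 := h.sq_apply w
  simp only [map_add, add_apply, h.comm hpos v u, h.comm hpos w u, h.comm hpos w v,
    hsymm v u, hsymm w u, hsymm w v] at e1 e2 e3 e4
  linear_combination (norm := module) (1 / 2 : ℝ) • (e1 - e2 - e3 - e4 + e5 + e6 + e7)

end IsSO3Tensor

lemma exists_cubic_root (n c : ℝ) : ∃ a : ℝ, a ^ 3 = 3 * n * a + 2 * c := by
  have hc : Continuous fun a : ℝ => a ^ 3 - 3 * n * a - 2 * c := by fun_prop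
  set K : ℝ := 1 + 3 * |n| + 2 * |c|
  have hn := abs_nonneg n
  have hc0 := abs_nonneg c
  have hK1 : 1 ≤ K := by simp only [K]; linarith
  have hK : 3 * |n| * K + 2 * |c| ≤ K ^ 3 := by
    have h1 : K * K ≤ K ^ 3 := by nlinarith [mul_nonneg (sub_nonneg.2 hK1) (sq_nonneg K)]
    have h2 : K * K = K + 3 * |n| * K + 2 * |c| * K := by simp only [K]; ring
    nlinarith
  have hnK : |n * K| = |n| * K := by rw [abs_mul, abs_of_pos (by linarith : 0 < K)]
  have hn' := abs_le.1 hnK.le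
  have hc' := abs_le.1 (le_refl |c|)
  obtain ⟨a, ha⟩ := mem_range_of_exists_le_of_exists_ge (c := 0) hc
    ⟨-K, by nlinarith⟩ ⟨K, by nlinarith⟩
  exact ⟨a, by linarith⟩

namespace IsSO3Tensor

/-- A vector `v` and its square `w` span a subalgebra with `v w = |v|² v` and
`w w = 2 g (v, w) v - |v|² w`. A direction `a v + w` is preserved by squaring as soon as `a` is a
root of a real cubic, and it is then rescaled to an idempotent. -/
lemma exists_idempotent [Nontrivial V] (h : IsSO3Tensor g Υ) (hsymm : ∀ u v, g u v = g v u)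
    (hpos : ∀ v, v ≠ 0 → 0 < g v v) : ∃ e, Υ e e = e ∧ g e e = 1 := by
  obtain ⟨u, t, hu, hut⟩ : ∃ (u : V) (t : ℝ), u ≠ 0 ∧ Υ u u = t • u := by
    obtain ⟨v, hv⟩ := exists_ne (0 : V)
    obtain ⟨a, ha⟩ := exists_cubic_root (g v v) (g v (Υ v v))
    by_cases h0 : a • v + Υ v v = 0
    · exact ⟨v, -a, hv, by rw [neg_smul]; exact eq_neg_of_add_eq_zero_right h0⟩
    · refine ⟨a • v + Υ v v, a ^ 2 - g v v, h0, ?_⟩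
      have e1 := h.sq_apply v
      have e2 := h.polarized hsymm hpos v v (Υ v v)
      simp only [e1, map_smul] at e2
      simp only [map_add, add_apply, map_smul, smul_apply, h.comm hpos (Υ v v) v, e1]
      have e3 : (a ^ 3 - 3 * g v v * a - 2 * g v (Υ v v)) • v = 0 := by
        rw [ha, show 3 * g v v * a + 2 * g v (Υ v v) - 3 * g v v * a - 2 * g v (Υ v v) = 0 by ring,
          zero_smul]
      linear_combination (norm := module) e2 - e3
  have e1 := h.sq_apply u
  rw [hut, map_smul, hut, smul_smul] at e1
  have ht : t * t = g u u := smul_left_injective ℝ hu e1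
  have hg := hpos u hu
  have ht0 : t ≠ 0 := by rintro rfl; simp at ht; linarith
  refine ⟨t⁻¹ • u, ?_, ?_⟩
  · simp only [map_smul, smul_apply, hut, smul_smul]
    congr 1
    field_simp
  · simp only [map_smul, smul_apply, smul_eq_mul, ← ht]
    field_simp

end IsSO3Tensor

/-- A `g`-orthogonal basis `e, Q₁, Q₂, P₁, P₂` of `V` in which `g` and `Υ` take their normal form.
The lengths `1, √3, √3, √2, √2` make all structure constants of the product `v w = Υ_v w`
rational. -/
structure IsAdapted (g : V →L[ℝ] V →L[ℝ] ℝ) (Υ : V →L[ℝ] V →L[ℝ] V)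
    (b : Module.Basis (Fin 5) ℝ V) : Prop where
  gram : ∀ i j, g (b i) (b j) = if i = j then ![1, 3, 3, 2, 2] i else 0
  mul :
    Υ (b 0) (b 0) = b 0 ∧ Υ (b 0) (b 1) = -b 1 ∧ Υ (b 0) (b 2) = -b 2 ∧
    Υ (b 0) (b 3) = (1 / 2 : ℝ) • b 3 ∧ Υ (b 0) (b 4) = (1 / 2 : ℝ) • b 4 ∧
    Υ (b 1) (b 1) = (-3 : ℝ) • b 0 ∧ Υ (b 1) (b 2) = 0 ∧ Υ (b 1) (b 3) = (3 / 2 : ℝ) • b 3 ∧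
    Υ (b 1) (b 4) = (-3 / 2 : ℝ) • b 4 ∧ Υ (b 2) (b 2) = (-3 : ℝ) • b 0 ∧
    Υ (b 2) (b 3) = (3 / 2 : ℝ) • b 4 ∧ Υ (b 2) (b 4) = (3 / 2 : ℝ) • b 3 ∧
    Υ (b 3) (b 3) = b 0 + b 1 ∧ Υ (b 3) (b 4) = b 2 ∧ Υ (b 4) (b 4) = b 0 - b 1
  comm : ∀ u v, Υ u v = Υ v u

namespace IsSO3Tensor

variable [Module.Finite ℝ V]

/-- Multiplication `L` by an idempotent `e` satisfies `2 L² + L = 1 + 2 g (e, ·) e`, so that it has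
the eigenvalues `-1` and `1/2` on the orthogonal complement of `e`; as `L` is trace free, both
eigenspaces are planes. -/
lemma finrank_eigenspace (h : IsSO3Tensor g Υ) (hsymm : ∀ u v, g u v = g v u)
    (hpos : ∀ v, v ≠ 0 → 0 < g v v) (hdim : Module.finrank ℝ V = 5) {e : V} (he : Υ e e = e)
    (hee : g e e = 1) :
    Module.finrank ℝ (LinearMap.ker ((Υ e : V →ₗ[ℝ] V) + LinearMap.id)) = 2 ∧
    Module.finrank ℝ (LinearMap.ker ((Υ e : V →ₗ[ℝ] V) - (1 / 2 : ℝ) • LinearMap.id)) = 2 := by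
  have hq : ∀ x, (2 : ℝ) • Υ e (Υ e x) + Υ e x = x + (2 * g e x) • e := by
    intro x
    have e1 := h.polarized hsymm hpos e e x
    rw [he, hee, h.comm hpos x e] at e1
    linear_combination (norm := module) e1
  have hL : ∀ x, g e (Υ e x) = g e x := fun x => by
    rw [h.symm_left, he, hsymm]
  have htr : LinearMap.trace ℝ V ((g e : V →ₗ[ℝ] ℝ).smulRight e) = 1 := by
    simp [LinearMap.trace_smulRight, hee]
  have h1 : LinearMap.IsProj (LinearMap.ker ((Υ e : V →ₗ[ℝ] V) + LinearMap.id))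
      ((1 / 3 : ℝ) • (LinearMap.id - (2 : ℝ) • (Υ e : V →ₗ[ℝ] V)
        + (g e : V →ₗ[ℝ] ℝ).smulRight e)) := by
    refine ⟨fun x => ?_, fun x hx => ?_⟩
    · have := hq x
      simp [LinearMap.mem_ker, he]
      linear_combination (norm := module) (-1 / 3 : ℝ) • this
    · have hx' : Υ e x + x = 0 := by simpa using hx
      have h0 : g e x = 0 := by
        have := congrArg (g e) hx'
        rw [map_add, hL, map_zero] at this
        linarith
      simp [h0]
      linear_combination (norm := module) (-2 / 3 : ℝ) • hx'
  have h2 : LinearMap.IsProj (LinearMap.ker ((Υ e : V →ₗ[ℝ] V) - (1 / 2 : ℝ) • LinearMap.id))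
      ((2 / 3 : ℝ) • (LinearMap.id + (Υ e : V →ₗ[ℝ] V))
        - (4 / 3 : ℝ) • (g e : V →ₗ[ℝ] ℝ).smulRight e) := by
    refine ⟨fun x => ?_, fun x hx => ?_⟩
    · have := hq x
      simp [LinearMap.mem_ker, he]
      linear_combination (norm := module) (1 / 3 : ℝ) • this
    · have hx' : Υ e x - (1 / 2 : ℝ) • x = 0 := by simpa using hx
      have h0 : g e x = 0 := by
        have := congrArg (g e) hx'
        rw [map_sub, hL, map_zero, map_smul, smul_eq_mul] at this
        linarith
      simp [h0]
      linear_combination (norm := module) (2 / 3 : ℝ) • hx'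
  have t1 := h1.trace
  have t2 := h2.trace
  simp only [map_smul, map_add, map_sub, LinearMap.trace_id, hdim, h.trace_free e, htr,
    smul_eq_mul] at t1 t2
  constructor
  · have : ((Module.finrank ℝ (LinearMap.ker ((Υ e : V →ₗ[ℝ] V) + LinearMap.id)) : ℕ) : ℝ) = 2 := by
      rw [← t1]; norm_num
    exact_mod_cast this
  · have : ((Module.finrank ℝ (LinearMap.ker ((Υ e : V →ₗ[ℝ] V)
        - (1 / 2 : ℝ) • LinearMap.id)) : ℕ) : ℝ) = 2 := by
      rw [← t2]; norm_num
    exact_mod_cast this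

/-- The normal form of `Υ`. With `Q` and `P` the eigenspaces of multiplication by an idempotent `e`
for `-1` and `1/2`, multiplication by `q ∈ Q` squares to `3/4 |q|²` on `P`, so that an orthogonal
basis `q₁, q₂` of `Q` and an eigenvector `p₁ ∈ P` of `q₁` determine the second basis vector of `P`
and all products. -/
theorem exists_isAdapted (h : IsSO3Tensor g Υ) (hsymm : ∀ u v, g u v = g v u)
    (hpos : ∀ v, v ≠ 0 → 0 < g v v) (hdim : Module.finrank ℝ V = 5) :
    ∃ b : Module.Basis (Fin 5) ℝ V, IsAdapted g Υ b := by
  have : Nontrivial V := Module.nontrivial_of_finrank_pos (R := ℝ) (by omega)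
  obtain ⟨e, he, hee⟩ := h.exists_idempotent hsymm hpos
  obtain ⟨hQ, hP⟩ := h.finrank_eigenspace hsymm hpos hdim he hee
  set Q := LinearMap.ker ((Υ e : V →ₗ[ℝ] V) + LinearMap.id)
  set P := LinearMap.ker ((Υ e : V →ₗ[ℝ] V) - (1 / 2 : ℝ) • LinearMap.id)
  have memQ : ∀ {x}, x ∈ Q ↔ Υ e x = -x := fun {x} => by
    simp [Q, eq_neg_iff_add_eq_zero]
  have memP : ∀ {x}, x ∈ P ↔ Υ e x = (1 / 2 : ℝ) • x := fun {x} => by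
    simp [P, sub_eq_zero]
  have hcomm := h.comm hpos
  have hpol := h.polarized hsymm hpos
  have adj : ∀ a x y, g (Υ a x) y = g x (Υ a y) := fun a x y => by
    rw [hsymm, h.symm_left]
  -- The eigenspaces of `Υ_e` are orthogonal to `e` and to each other.
  have eQ : ∀ q ∈ Q, g e q = 0 := fun q hq => by
    have := adj e e q
    rw [he, memQ.1 hq, map_neg] at this
    linarith
  have eP : ∀ p ∈ P, g e p = 0 := fun p hp => by
    have := adj e e p
    rw [he, memP.1 hp, map_smul, smul_eq_mul] at this
    linarith
  have QP : ∀ q ∈ Q, ∀ p ∈ P, g q p = 0 := fun q hq p hp => by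
    have := adj e q p
    rw [memQ.1 hq, memP.1 hp, map_smul, map_neg, neg_apply, smul_eq_mul] at this
    linarith
  -- `Q Q ⊆ ℝ e` and `Q P ⊆ P`, and `Q` acts on `P` as a Clifford module.
  have QQ : ∀ q ∈ Q, ∀ q' ∈ Q, Υ q q' = -g q q' • e := fun q hq q' hq' => by
    have e1 := hpol e q q'
    rw [memQ.1 hq, memQ.1 hq', map_neg, map_neg, hcomm q' q, eQ q hq, eQ q' hq'] at e1
    have e2 := congrArg (Υ e) e1
    have e3 := hpol e e (Υ q q')
    rw [he, hee, hcomm (Υ q q') e, ← adj, hcomm q e, memQ.1 hq, map_neg, neg_apply] at e3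
    simp only [map_add, map_smul, map_neg, map_zero, zero_smul, he] at e2
    simp only [zero_smul] at e1
    linear_combination (norm := module)
      (1 / 9 : ℝ) • (e3 - (2 : ℝ) • e2 - (5 : ℝ) • e1)
  have QPP : ∀ q ∈ Q, ∀ p ∈ P, Υ q p ∈ P := fun q hq p hp => by
    have e1 := hpol e q p
    rw [memQ.1 hq, memP.1 hp, map_neg, map_smul, hcomm p q, eQ q hq, eP p hp, QP q hq p hp] at e1
    rw [memP]
    linear_combination (norm := module) e1
  have cliff : ∀ q ∈ Q, ∀ q' ∈ Q, ∀ p ∈ P,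
      Υ q (Υ q' p) + Υ q' (Υ q p) = (3 / 2 * g q q') • p := fun q hq q' hq' p hp => by
    have e1 := hpol q q' p
    rw [QQ q hq q' hq', map_smul, hcomm p e, memP.1 hp, QP q hq p hp, QP q' hq' p hp] at e1
    linear_combination (norm := module) e1
  have PP : ∀ p ∈ P, ∀ p' ∈ P, Υ e (Υ p p') + Υ p p' = g p p' • e := fun p hp p' hp' => by
    have e1 := hpol e p p'
    rw [memP.1 hp, memP.1 hp', map_smul, map_smul, hcomm p' p, eP p hp, eP p' hp'] at e1
    linear_combination (norm := module) e1
  have PPP : ∀ p ∈ P, ∀ p' ∈ P, ∀ p'' ∈ P, g p'' (Υ p p') = 0 := fun p hp p' hp' p'' hp'' => by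
    have e1 := congrArg (g p'') (PP p hp p' hp')
    rw [map_add, ← adj, memP.1 hp'', map_smul, map_smul, hsymm p'' e, eP p'' hp'', smul_apply,
      smul_eq_mul, smul_zero] at e1
    linarith
  -- An orthogonal basis of `Q`.
  obtain ⟨q₁, hq₁, g11⟩ : ∃ q ∈ Q, g q q = 3 := by
    have : Nontrivial Q := Module.nontrivial_of_finrank_pos (R := ℝ) (by omega)
    obtain ⟨⟨q, hq⟩, hq0⟩ := exists_ne (0 : Q)
    obtain ⟨c, hc⟩ := exists_smul_inner_self_eq hpos (v := q) (by simpa using hq0) (r := 3)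
      (by norm_num)
    exact ⟨c • q, Q.smul_mem c hq, hc⟩
  have hq₁0 : q₁ ≠ 0 := by rintro rfl; simp at g11
  obtain ⟨q₂, hq₂, g22, g12⟩ : ∃ q ∈ Q, g q q = 3 ∧ g q₁ q = 0 := by
    obtain ⟨⟨q, hq⟩, hli⟩ := exists_linearIndependent_pair_of_one_lt_finrank (R := ℝ) (M := Q)
      (by omega) (x := ⟨q₁, hq₁⟩) (by simpa using hq₁0)
    have h0 : q - (g q₁ q / 3) • q₁ ≠ 0 := by
      intro h0
      rw [LinearIndependent.pair_iff] at hli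
      have := hli (-(g q₁ q / 3)) 1 (by
        ext
        simp only [Submodule.coe_add, Submodule.coe_smul, Submodule.coe_zero]
        linear_combination (norm := module) h0)
      exact one_ne_zero this.2
    obtain ⟨c, hc⟩ := exists_smul_inner_self_eq hpos h0 (r := 3) (by norm_num)
    refine ⟨_, Q.smul_mem c (Q.sub_mem hq (Q.smul_mem _ hq₁)), hc, ?_⟩
    simp only [map_smul, map_sub, smul_eq_mul, g11]
    ring
  obtain ⟨p₁, hp₁, g33, m13⟩ : ∃ p ∈ P, g p p = 2 ∧ Υ q₁ p = (3 / 2 : ℝ) • p := by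
    suffices ∃ p ∈ P, p ≠ 0 ∧ Υ q₁ p = (3 / 2 : ℝ) • p by
      obtain ⟨p, hp, hp0, hpe⟩ := this
      obtain ⟨c, hc⟩ := exists_smul_inner_self_eq hpos hp0 (r := 2) (by norm_num)
      refine ⟨c • p, P.smul_mem c hp, hc, ?_⟩
      rw [map_smul, hpe, smul_comm]
    have : Nontrivial P := Module.nontrivial_of_finrank_pos (R := ℝ) (by omega)
    obtain ⟨⟨p, hp⟩, hp0⟩ := exists_ne (0 : P)
    have hp0' : p ≠ 0 := by simpa using hp0
    have c11 := cliff q₁ hq₁ q₁ hq₁ p hp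
    rw [g11] at c11
    -- If `p + 2/3 q₁ p` vanishes, `p` is an eigenvector of `q₁` for the other eigenvalue `-3/2`,
    -- and `q₂` interchanges the two eigenlines, as it anticommutes with `q₁`.
    by_cases h0 : p + (2 / 3 : ℝ) • Υ q₁ p = 0
    · refine ⟨Υ q₂ p, QPP q₂ hq₂ p hp, fun h1 => hp0' ?_, ?_⟩
      · have c22 := cliff q₂ hq₂ q₂ hq₂ p hp
        rw [h1, g22, map_zero] at c22
        linear_combination (norm := module) (-2 / 9 : ℝ) • c22
      · have c12 := cliff q₁ hq₁ q₂ hq₂ p hp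
        rw [g12] at c12
        have h2 : Υ q₁ p = (-3 / 2 : ℝ) • p := by
          linear_combination (norm := module) (3 / 2 : ℝ) • h0
        rw [h2, map_smul] at c12
        linear_combination (norm := module) c12
    · refine ⟨_, P.add_mem hp (P.smul_mem _ (QPP q₁ hq₁ p hp)), h0, ?_⟩
      rw [map_add, map_smul]
      linear_combination (norm := module) (1 / 3 : ℝ) • c11
  obtain ⟨p₂, hp₂, m23⟩ : ∃ p ∈ P, Υ q₂ p₁ = (3 / 2 : ℝ) • p :=
    ⟨(2 / 3 : ℝ) • Υ q₂ p₁, P.smul_mem _ (QPP q₂ hq₂ p₁ hp₁), by module⟩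
  have m24 : Υ q₂ p₂ = (3 / 2 : ℝ) • p₁ := by
    have c22 := cliff q₂ hq₂ q₂ hq₂ p₁ hp₁
    rw [m23, g22, map_smul] at c22
    linear_combination (norm := module) (1 / 3 : ℝ) • c22
  have m14 : Υ q₁ p₂ = (-3 / 2 : ℝ) • p₂ := by
    have c12 := cliff q₁ hq₁ q₂ hq₂ p₁ hp₁
    rw [m23, m13, g12, map_smul, map_smul, m23] at c12
    linear_combination (norm := module) (2 / 3 : ℝ) • c12
  have g34 : g p₁ p₂ = 0 := by
    have := adj q₁ p₁ p₂
    rw [m13, m14] at this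
    simp only [map_smul, smul_apply, smul_eq_mul] at this
    linarith
  have g44 : g p₂ p₂ = 2 := by
    have := adj q₂ p₁ p₂
    rw [m23, m24] at this
    simp only [map_smul, smul_apply, smul_eq_mul, g33] at this
    linarith
  -- The five vectors are orthogonal, hence a basis.
  set v : Fin 5 → V := ![e, q₁, q₂, p₁, p₂] with hv
  have gram : ∀ i j, g (v i) (v j) = if i = j then ![1, 3, 3, 2, 2] i else 0 := by
    intro i j
    fin_cases i <;> fin_cases j <;>
      simp [hv, hee, g11, g22, g33, g44, g12, g34, eQ, eP, QP, hq₁, hq₂, hp₁, hp₂, hsymm q₁ e,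
        hsymm q₂ e, hsymm p₁ e, hsymm p₂ e, hsymm q₂ q₁, hsymm p₂ p₁, hsymm p₁ q₁, hsymm p₂ q₁,
        hsymm p₁ q₂, hsymm p₂ q₂]
  have hli : LinearIndependent ℝ v := by
    rw [Fintype.linearIndependent_iff]
    intro c hc i
    have := congrArg (g (v i)) hc
    simp only [map_sum, map_smul, smul_eq_mul, gram, map_zero, mul_ite, mul_zero,
      Finset.sum_ite_eq, Finset.mem_univ, if_true] at this
    refine (mul_eq_zero.1 this).resolve_right ?_
    fin_cases i <;> norm_num
  let b := basisOfLinearIndependentOfCardEqFinrank hli (by simp [hdim])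
  have hb : ⇑b = v := coe_basisOfLinearIndependentOfCardEqFinrank hli _
  have hext : ∀ x y : V, (∀ i, g (v i) x = g (v i) y) → x = y := fun x y hxy =>
    eq_of_forall_inner_basis_eq hpos b (by simpa only [hb] using hxy)
  have m33 : ∀ p ∈ P, ∀ p' ∈ P, ∀ i, g (v i) (Υ p p') =
      ![g p p' / 2, g (Υ q₁ p) p', g (Υ q₂ p) p', 0, 0] i := by
    intro p hp p' hp' i
    have flip : ∀ x, g x (Υ p p') = g (Υ x p) p' := fun x => by rw [hcomm x p, adj]
    fin_cases i
    · simp [hv, flip, memP.1 hp]; ring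
    · simp [hv, flip]
    · simp [hv, flip]
    · simpa [hv] using PPP p hp p' hp' p₁ hp₁
    · simpa [hv] using PPP p hp p' hp' p₂ hp₂
  refine ⟨b, by simpa only [hb] using gram,
    ⟨?_, ?_, ?_, ?_, ?_, ?_, ?_, ?_, ?_, ?_, ?_, ?_, ?_, ?_, ?_⟩, hcomm⟩ <;> rw [hb]
  · exact he
  · exact memQ.1 hq₁
  · exact memQ.1 hq₂
  · exact memP.1 hp₁
  · exact memP.1 hp₂
  · exact (QQ q₁ hq₁ q₁ hq₁).trans (by rw [g11]; rfl)
  · exact (QQ q₁ hq₁ q₂ hq₂).trans (by rw [g12, neg_zero, zero_smul])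
  · exact m13
  · exact m14
  · exact (QQ q₂ hq₂ q₂ hq₂).trans (by rw [g22]; rfl)
  · exact m23
  · exact m24
  · refine hext _ _ fun i => ?_
    rw [map_add, gram, gram, show v 3 = p₁ from rfl, m33 p₁ hp₁ p₁ hp₁ i, m13, m23, hsymm (_ • p₂)]
    fin_cases i <;> simp [g33, g34]
  · refine hext _ _ fun i => ?_
    rw [gram, show v 3 = p₁ from rfl, show v 4 = p₂ from rfl, m33 p₁ hp₁ p₂ hp₂ i, m13, m23]
    fin_cases i <;> simp [g44, g34]
  · refine hext _ _ fun i => ?_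
    rw [map_sub, gram, gram, show v 4 = p₂ from rfl, m33 p₂ hp₂ p₂ hp₂ i, m14, m24]
    fin_cases i <;> simp [g44, g34]

end IsSO3Tensor

end PointwiseAlgebra

/-! ### Multilinear functions and bases -/

section Multilinear

variable {V : Type*} [AddCommGroup V] [Module ℝ V]

lemma linear_eq_zero_of_basis {ι W : Type*} [AddCommGroup W] [Module ℝ W]
    (b : Module.Basis ι ℝ V) {f : V → W} (hf : IsLinearMap ℝ f) (h : ∀ i, f (b i) = 0)
    (u : V) : f u = 0 :=
  LinearMap.congr_fun (b.ext (f₁ := hf.mk' f) (f₂ := 0) h) u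

lemma trilinear_eq_zero_of_basis {ι W : Type*} [AddCommGroup W] [Module ℝ W]
    (b : Module.Basis ι ℝ V) {f : V → V → V → W} (h₁ : ∀ v w, IsLinearMap ℝ fun u => f u v w)
    (h₂ : ∀ u w, IsLinearMap ℝ fun v => f u v w) (h₃ : ∀ u v, IsLinearMap ℝ fun w => f u v w)
    (h : ∀ i j k, f (b i) (b j) (b k) = 0) (u v w : V) : f u v w = 0 :=
  linear_eq_zero_of_basis b (h₁ v w) (fun i => linear_eq_zero_of_basis b (h₂ (b i) w)
    (fun j => linear_eq_zero_of_basis b (h₃ (b i) (b j)) (h i j) w) v) u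

/-- A skew bilinear function vanishes if it does so on pairs `b i, b j` with `i < j`. -/
lemma skew_eq_zero_of_basis {n : ℕ} (b : Module.Basis (Fin n) ℝ V) {f : V → V → ℝ}
    (hf : ∀ v, IsLinearMap ℝ fun u => f u v) (hskew : ∀ u v, f u v = -f v u)
    (h : ∀ i j, i < j → f (b i) (b j) = 0) (u v : V) : f u v = 0 := by
  refine linear_eq_zero_of_basis b (hf v) (fun i => ?_) u
  rw [hskew, neg_eq_zero]
  refine linear_eq_zero_of_basis b (hf (b i)) (fun j => ?_) v
  rcases lt_trichotomy i j with hij | rfl | hij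
  · rw [hskew, h i j hij, neg_zero]
  · linarith [hskew (b i) (b i)]
  · exact h j i hij

/-- A symmetric trilinear function vanishes if it does so on sorted triples of basis vectors. -/
lemma symm_eq_zero_of_basis {n : ℕ} (b : Module.Basis (Fin n) ℝ V) {f : V → V → V → ℝ}
    (hf : ∀ v w, IsLinearMap ℝ fun u => f u v w) (h₁₂ : ∀ u v w, f u v w = f v u w)
    (h₂₃ : ∀ u v w, f u v w = f u w v)
    (h : ∀ i j k, i ≤ j → j ≤ k → f (b i) (b j) (b k) = 0) (u v w : V) : f u v w = 0 := by
  have h' : ∀ i j k, f (b i) (b j) (b k) = 0 := by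
    intro i j k
    rcases le_total i j with h1 | h1 <;> rcases le_total j k with h2 | h2 <;>
      rcases le_total i k with h3 | h3
    · exact h _ _ _ h1 h2
    · exact h _ _ _ h1 h2
    · rw [h₂₃]; exact h _ _ _ h3 h2
    · rw [h₂₃, h₁₂]; exact h _ _ _ h3 h1
    · rw [h₁₂]; exact h _ _ _ h1 h3
    · rw [h₁₂, h₂₃]; exact h _ _ _ h2 h3
    · rw [h₁₂, h₂₃, h₁₂]; exact h _ _ _ h2 h1
    · rw [h₁₂, h₂₃, h₁₂]; exact h _ _ _ h2 h1
  refine linear_eq_zero_of_basis b (hf v w) (fun i => ?_) u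
  rw [h₁₂]
  refine linear_eq_zero_of_basis b (hf (b i) w) (fun j => ?_) v
  rw [h₂₃, h₁₂]
  exact linear_eq_zero_of_basis b (hf (b j) (b i)) (fun k => h' _ _ _) w

/-- A totally skew trilinear function vanishes if it does so on strictly sorted triples of basis
vectors. -/
lemma alternating_eq_zero_of_basis {n : ℕ} (b : Module.Basis (Fin n) ℝ V) {f : V → V → V → ℝ}
    (hf : ∀ v w, IsLinearMap ℝ fun u => f u v w) (h₁₂ : ∀ u v w, f u v w = -f v u w)
    (h₂₃ : ∀ u v w, f u v w = -f u w v)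
    (h : ∀ i j k, i < j → j < k → f (b i) (b j) (b k) = 0) (u v w : V) : f u v w = 0 := by
  refine skew_eq_zero_of_basis b (f := fun u v => f u v w) (hf · w) (h₁₂ · · w)
    (fun i j hij => ?_) u v
  rw [h₂₃, h₁₂, neg_neg]
  refine linear_eq_zero_of_basis b (hf (b i) (b j)) (fun k => ?_) w
  rcases lt_trichotomy k i with hk | rfl | hk
  · exact h k i j hk hij
  · linarith [h₁₂ (b k) (b k) (b j)]
  · rw [h₁₂, neg_eq_zero]
    rcases lt_trichotomy k j with hk' | rfl | hk'
    · exact h i k j hk hk'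
    · linarith [h₂₃ (b i) (b k) (b k)]
    · rw [h₂₃, h i j k hij hk', neg_zero]

/-- The alternation of the trilinear form with coefficients `s` in the basis `b`. -/
lemma exists_lambdaThree {ι : Type*} (b : Module.Basis ι ℝ V) (s : ι → ι → ι → ℝ) :
    ∃ T ∈ lambdaThree V, ∀ i j k, T.1 (b i) (b j) (b k) =
      s i j k + s j k i + s k i j - s j i k - s i k j - s k j i := by
  let S : V →ₗ[ℝ] V →ₗ[ℝ] V →ₗ[ℝ] ℝ :=
    b.constr ℝ fun i => b.constr ℝ fun j => b.constr ℝ fun k => s i j k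
  have hS : ∀ i j k, S (b i) (b j) (b k) = s i j k := fun i j k => by
    simp only [S, Module.Basis.constr_basis]
  let T : V →ₗ[ℝ] V →ₗ[ℝ] V →ₗ[ℝ] ℝ := LinearMap.mk₂ ℝ
    (fun u v => S u v + (S v).flip u + (S.flip u).flip v - S v u - (S u).flip v - (S.flip v).flip u)
    (fun u u' v => by ext w; simp; ring) (fun c u v => by ext w; simp; ring)
    (fun u v v' => by ext w; simp; ring) (fun c u v => by ext w; simp; ring)
  have hT : ∀ u v w, T u v w =
      S u v w + S v w u + S w u v - S v u w - S u w v - S w v u := fun u v w => rfl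
  refine ⟨⟨T, fun u v w => ?_⟩, fun u v w => ?_, fun i j k => ?_⟩
  · rw [hT, hT]; ring
  · change T u v w = -T u w v
    rw [hT, hT]; ring
  · simp only [hT, hS]

end Multilinear

/-! ### The kernel of `Υ'` in an adapted basis -/

section AdaptedBasis

variable {V : Type*} [AddCommGroup V] [Module ℝ V] [TopologicalSpace V]
  [IsTopologicalAddGroup V] [ContinuousSMul ℝ V]
  {g : V →L[ℝ] V →L[ℝ] ℝ} {Υ : V →L[ℝ] V →L[ℝ] V} {b : Module.Basis (Fin 5) ℝ V}

/-- The derivative of the trilinear form of `Υ` along an endomorphism, written with the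
endomorphism in the first slot of `g`. -/
lemma form_deriv_eq (hcomm : ∀ u v, Υ u v = Υ v u)
    (hadj : ∀ u v w, g u (Υ v w) = g w (Υ v u)) (X : V →ₗ[ℝ] V) (u v w : V) :
    form g Υ (X u) v w + form g Υ u (X v) w + form g Υ u v (X w) =
      g (X u) (Υ v w) + g (X v) (Υ u w) + g (X w) (Υ u v) := by
  simp only [form]
  rw [hcomm w v, hadj u w (X v), hcomm w u, hcomm (X w) v, hadj u v (X w), hcomm v u]

namespace IsAdapted

lemma symm (hb : IsAdapted g Υ b) (u v : V) : g u v = g v u := by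
  refine sub_eq_zero.1 (linear_eq_zero_of_basis b (f := fun u => g u v - g v u)
    ⟨fun x y => by simp; ring, fun c x => by simp; ring⟩ (fun i => ?_) u)
  refine linear_eq_zero_of_basis b (f := fun v => g (b i) v - g v (b i))
    ⟨fun x y => by simp; ring, fun c x => by simp; ring⟩ (fun j => ?_) v
  simp only [hb.gram]
  split_ifs with h1 h2 h2 <;> simp_all

/-- Skew endomorphisms with prescribed matrix entries. -/
lemma exists_skew (hb : IsAdapted g Υ b) (s : Fin 5 → Fin 5 → ℝ) :
    ∃ X : V →ₗ[ℝ] V, (∀ u v, g (X u) v = -g u (X v)) ∧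
      ∀ i j, g (b i) (X (b j)) = s i j - s j i := by
  let X : V →ₗ[ℝ] V := b.constr ℝ fun j =>
    ∑ i, ((s i j - s j i) / (![1, 3, 3, 2, 2] : Fin 5 → ℝ) i) • b i
  have hX : ∀ i j, g (b i) (X (b j)) = s i j - s j i := fun i j => by
    simp only [X, Module.Basis.constr_basis, map_sum, map_smul, smul_eq_mul, hb.gram, mul_ite,
      mul_zero, Finset.sum_ite_eq, Finset.mem_univ, if_true]
    have : (![1, 3, 3, 2, 2] : Fin 5 → ℝ) i ≠ 0 := by fin_cases i <;> norm_num
    exact div_mul_cancel₀ _ this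
  refine ⟨X, fun u v => ?_, hX⟩
  refine eq_neg_of_add_eq_zero_left (linear_eq_zero_of_basis b
    (f := fun u => g (X u) v + g u (X v))
    ⟨fun x y => by simp; ring, fun c x => by simp; ring⟩ (fun i => ?_) u)
  refine linear_eq_zero_of_basis b (f := fun v => g (X (b i)) v + g (b i) (X v))
    ⟨fun x y => by simp; ring, fun c x => by simp; ring⟩ (fun j => ?_) v
  rw [hb.symm, hX, hX]
  ring

/-- The equations of `so(3)` in an adapted basis; the three entries of the matrix of `X` that remain
free are those at `(0, 3)`, `(0, 4)` and `(3, 4)`. -/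
lemma mem_so3_iff (hb : IsAdapted g Υ b)
    (hadj : ∀ u v w, g u (Υ v w) = g w (Υ v u)) {X : V →ₗ[ℝ] V}
    (hX : ∀ u v, g (X u) v = -g u (X v)) :
    X ∈ so3 g Υ ↔ g (b 0) (X (b 1)) = 0 ∧ g (b 0) (X (b 2)) = 0 ∧
      g (b 1) (X (b 2)) = 3 * g (b 3) (X (b 4)) ∧ g (b 1) (X (b 3)) = -g (b 0) (X (b 3)) ∧
      g (b 1) (X (b 4)) = g (b 0) (X (b 4)) ∧ g (b 2) (X (b 3)) = -g (b 0) (X (b 4)) ∧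
      g (b 2) (X (b 4)) = -g (b 0) (X (b 3)) := by
  have hdiag : ∀ u, g u (X u) = 0 := fun u => by linarith [hX u u, hb.symm (X u) u]
  have hflip : ∀ u v, g v (X u) = -g u (X v) := fun u v => by rw [← hX, hb.symm]
  have hflips : ∀ i j, i < j → g (b j) (X (b i)) = -g (b i) (X (b j)) := fun i j _ => hflip _ _
  constructor
  · intro h
    have H : ∀ i j k, g (b i) (X (Υ (b j) (b k))) + g (b j) (X (Υ (b i) (b k)))
        + g (b k) (X (Υ (b i) (b j))) = 0 := fun i j k => by
      have := h.2 (b i) (b j) (b k)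
      rw [form_deriv_eq hb.comm hadj] at this
      simp only [hX] at this
      linarith
    have h001 := H 0 0 1
    have h002 := H 0 0 2
    have h134 := H 1 3 4
    have h013 := H 0 1 3
    have h014 := H 0 1 4
    have h023 := H 0 2 3
    have h024 := H 0 2 4
    simp only [hb.mul, map_neg, map_smul, smul_eq_mul, hflips, Fin.reduceLT]
      at h001 h002 h134 h013 h014 h023 h024
    refine ⟨?_, ?_, ?_, ?_, ?_, ?_, ?_⟩ <;> linarith
  · rintro ⟨h01, h02, h12, h13, h14, h23, h24⟩
    refine ⟨hX, fun u v w => ?_⟩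
    rw [form_deriv_eq hb.comm hadj]
    refine symm_eq_zero_of_basis b
      (f := fun u v w => g (X u) (Υ v w) + g (X v) (Υ u w) + g (X w) (Υ u v))
      (fun v w => ⟨fun x y => by simp; ring, fun c x => by simp; ring⟩)
      (fun u v w => by simp only [hb.comm v u]; ring)
      (fun u v w => by simp only [hb.comm w v]; ring) (fun i j k hij hjk => ?_) u v w
    simp only [hX]
    fin_cases i <;> fin_cases j <;> first
      | exact absurd hij (by decide)
      | (clear hij
         fin_cases k <;> first
          | exact absurd hjk (by decide)
          | (simp only [Fin.reduceFinMk, Fin.zero_eta, Fin.mk_one, hb.mul, map_add, map_sub,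
              map_neg, map_zero, map_smul, smul_eq_mul, hdiag, hflips, Fin.reduceLT,
              h01, h02, h12, h13, h14, h23, h24]
             ring))

/-- Moving indices across the slots of a totally skew tensor, the equations of `so(3)` in its first
two slots annihilate all its coefficients. -/
lemma disjoint (hb : IsAdapted g Υ b) (hadj : ∀ u v w, g u (Υ v w) = g w (Υ v u)) :
    Disjoint (so3Tensor g Υ) (lambdaThree V) := by
  rw [Submodule.disjoint_def]
  intro A hA hA'
  set a : Fin 5 → Fin 5 → Fin 5 → ℝ := fun i j k => A.1 (b i) (b j) (b k) with ha
  have s12 : ∀ i j k, a i j k = -a j i k := fun i j k => A.2 _ _ _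
  have s23 : ∀ i j k, a i j k = -a i k j := fun i j k => hA' _ _ _
  have R : ∀ k, a 0 1 k = 0 ∧ a 0 2 k = 0 ∧ a 1 2 k = 3 * a 3 4 k ∧ a 1 3 k = -a 0 3 k ∧
      a 1 4 k = a 0 4 k ∧ a 2 3 k = -a 0 4 k ∧ a 2 4 k = -a 0 3 k := fun k => by
    obtain ⟨X, hX, hAX⟩ := hA (b k)
    simpa only [ha, hAX] using (hb.mem_so3_iff hadj hX.1).1 hX
  obtain ⟨r00, r01, r02, r03, r04, r05, r06⟩ := R 0
  obtain ⟨r10, r11, r12, r13, r14, r15, r16⟩ := R 1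
  obtain ⟨r20, r21, r22, r23, r24, r25, r26⟩ := R 2
  obtain ⟨r30, r31, r32, r33, r34, r35, r36⟩ := R 3
  obtain ⟨r40, r41, r42, r43, r44, r45, r46⟩ := R 4
  have h034 : a 0 3 4 = 0 := by
    linarith [s23 0 3 4, s12 0 4 3, s23 4 0 3, s12 4 3 0, s23 1 2 0, s12 1 0 2]
  have h123 : a 1 2 3 = 0 := by
    linarith [s23 1 2 3, s23 0 3 2]
  have h124 : a 1 2 4 = 0 := by
    linarith [s23 1 2 4, s23 0 4 2]
  have h134 : a 1 3 4 = 0 := by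
    linarith [s23 1 3 4, s12 1 4 3, s23 4 1 3, s12 4 3 1, s23 1 2 1, s12 1 1 2]
  have h234 : a 2 3 4 = 0 := by
    linarith [s23 2 3 4, s12 2 4 3, s23 4 2 3, s12 4 3 2, s23 1 2 2]
  have hA0 : ∀ u v w, A.1 u v w = 0 :=
    alternating_eq_zero_of_basis b (f := fun u v w => A.1 u v w)
      (fun v w => ⟨fun x y => by simp, fun c x => by simp⟩) A.2 hA' (fun i j k hij hjk => by
        change a i j k = 0
        fin_cases i <;> fin_cases j <;> first
          | exact absurd hij (by decide)
          | (clear hij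
             fin_cases k <;> first
              | exact absurd hjk (by decide)
              | assumption))
  ext u v w
  exact hA0 u v w

lemma ker_le (hb : IsAdapted g Υ b) (hadj : ∀ u v w, g u (Υ v w) = g w (Υ v u)) :
    LinearMap.ker (upsilonPrime Υ) ≤ so3Tensor g Υ ⊔ lambdaThree V := by
  intro A hA
  set a : Fin 5 → Fin 5 → Fin 5 → ℝ := fun i j k => A.1 (b i) (b j) (b k) with ha
  have s12 : ∀ i j k, i < j → a j i k = -a i j k := fun i j k _ => A.2 _ _ _
  have s11 : ∀ i k, a i i k = 0 := fun i k => by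
    have : a i i k = -a i i k := A.2 _ _ _
    linarith
  -- The equations of `so(3)` force the values of `T` at increasing triples: they express the value
  -- of `A - T` there by its values at triples with a repeated index, at which `T` vanishes.
  obtain ⟨T, hT, hTb⟩ := exists_lambdaThree b fun i j k =>
    if i < j ∧ j < k then a i j k + (if (i, j, k) = (0, 3, 4) then a 2 4 4
      else if (i, j, k) = (1, 2, 3) then -3 * a 3 4 3
      else if (i, j, k) = (1, 2, 4) then -3 * a 3 4 4
      else if (i, j, k) = (1, 3, 4) then -a 2 4 4 else if (i, j, k) = (2, 3, 4) then a 0 4 4 else 0)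
    else 0
  suffices A + (-1 : ℝ) • T ∈ so3Tensor g Υ by
    have hA : A = (A + (-1 : ℝ) • T) + T := by module
    rw [hA]
    exact Submodule.add_mem_sup this hT
  -- With this `T`, each of the seven equations for each `k` is a linear combination of the
  -- equations `Υ' (A) = 0` at quadruples of basis vectors.
  have R : ∀ k, (A + (-1 : ℝ) • T).1 (b 0) (b 1) (b k) = 0 ∧
      (A + (-1 : ℝ) • T).1 (b 0) (b 2) (b k) = 0 ∧
      (A + (-1 : ℝ) • T).1 (b 1) (b 2) (b k) = 3 * (A + (-1 : ℝ) • T).1 (b 3) (b 4) (b k) ∧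
      (A + (-1 : ℝ) • T).1 (b 1) (b 3) (b k) = -(A + (-1 : ℝ) • T).1 (b 0) (b 3) (b k) ∧
      (A + (-1 : ℝ) • T).1 (b 1) (b 4) (b k) = (A + (-1 : ℝ) • T).1 (b 0) (b 4) (b k) ∧
      (A + (-1 : ℝ) • T).1 (b 2) (b 3) (b k) = -(A + (-1 : ℝ) • T).1 (b 0) (b 4) (b k) ∧
      (A + (-1 : ℝ) • T).1 (b 2) (b 4) (b k) = -(A + (-1 : ℝ) • T).1 (b 0) (b 3) (b k) := by
    have H : ∀ i j k l, upsilonPrime Υ A (b i) (b j) (b k) (b l) = 0 := fun i j k l => by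
      rw [LinearMap.mem_ker.1 hA]; rfl
    have haA : ∀ i j k, A.1 (b i) (b j) (b k) = a i j k := fun _ _ _ => rfl
    have h0001 := H 0 0 0 1
    have h0002 := H 0 0 0 2
    have h0011 := H 0 0 1 1
    have h0012 := H 0 0 1 2
    have h0013 := H 0 0 1 3
    have h0014 := H 0 0 1 4
    have h0022 := H 0 0 2 2
    have h0023 := H 0 0 2 3
    have h0024 := H 0 0 2 4
    have h0234 := H 0 2 3 4
    have h0244 := H 0 2 4 4
    have h1112 := H 1 1 1 2
    have h1113 := H 1 1 1 3
    have h1114 := H 1 1 1 4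
    have h1244 := H 1 2 4 4
    have h1334 := H 1 3 3 4
    have h1344 := H 1 3 4 4
    have h2222 := H 2 2 2 2
    have h2223 := H 2 2 2 3
    have h2224 := H 2 2 2 4
    have h2234 := H 2 2 3 4
    have h2244 := H 2 2 4 4
    have h2333 := H 2 3 3 3
    have h2444 := H 2 4 4 4
    have h3333 := H 3 3 3 3
    have h3444 := H 3 4 4 4
    have h4444 := H 4 4 4 4
    simp only [upsilonPrime, LinearMap.coe_mk, AddHom.coe_mk, hb.mul, map_add, map_sub, map_neg,
      map_zero, map_smul, LinearMap.add_apply, LinearMap.sub_apply, LinearMap.neg_apply,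
      LinearMap.zero_apply, LinearMap.smul_apply, smul_eq_mul, haA, s12, s11, Fin.reduceLT]
      at h0001 h0002 h0011 h0012 h0013 h0014 h0022 h0023 h0024 h0234 h0244 h1112 h1113 h1114
        h1244 h1334 h1344 h2222 h2223 h2224 h2234 h2244 h2333 h2444 h3333 h3444 h4444
    intro k
    simp only [Submodule.coe_add, Submodule.coe_smul, LinearMap.add_apply, LinearMap.smul_apply,
      hTb, haA]
    fin_cases k <;> simp only [Fin.reduceFinMk, Fin.zero_eta, Fin.mk_one, Fin.reduceLT,
      Fin.reduceEq, Prod.mk.injEq, if_true, if_false, and_true, and_false, and_self, s12, s11]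
    · refine ⟨by linear_combination 1 / 9 * h0001,
        by linear_combination 1 / 9 * h0002,
        by linear_combination -1 * h0244 + 1 / 9 * h0002,
        by linear_combination -1 / 3 * h0013,
        by linear_combination -1 / 3 * h0014,
        by linear_combination -1 / 3 * h0023,
        by linear_combination -1 / 3 * h0024⟩
    · refine ⟨by linear_combination 1 / 6 * h0011,
        by linear_combination 1 / 3 * h0012,
        by linear_combination -1 / 9 * h1112 - 1 * h1244,
        by linear_combination -1 / 9 * h1113,
        by linear_combination 1 / 9 * h1114,
        by linear_combination -1 / 18 * h1114 + 1 / 2 * h1334,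
        by linear_combination -1 / 18 * h1113 + 1 / 2 * h1344⟩
    · refine ⟨by ring,
        by linear_combination 1 / 6 * h0022,
        by linear_combination -1 / 36 * h2222 - 1 / 2 * h2244,
        by linear_combination 1 / 3 * h2333,
        by linear_combination -1 / 3 * h2444,
        by linear_combination -1 / 9 * h2224,
        by linear_combination -1 / 9 * h2223⟩
    · refine ⟨by ring,
        by ring,
        by ring,
        by linear_combination 1 / 12 * h3333,
        by linear_combination -1 / 3 * h3444,
        by linear_combination -1 / 3 * h2234,
        by linear_combination -2 / 3 * h0234 + 1 / 54 * h2222⟩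
    · refine ⟨by ring,
        by ring,
        by ring,
        by ring,
        by linear_combination -1 / 12 * h4444,
        by ring,
        by ring⟩
  -- Membership in `so(3) ⊗ V` holds for `b k` in the last slot, and extends linearly.
  intro v
  have hX : ∀ k, ∃ X ∈ so3 g Υ, ∀ u w, (A + (-1 : ℝ) • T).1 u w (b k) = g u (X w) := by
    intro k
    obtain ⟨X, hX, hXb⟩ := hb.exists_skew fun i j => (A + (-1 : ℝ) • T).1 (b i) (b j) (b k) / 2
    have hXb' : ∀ i j, g (b i) (X (b j)) = (A + (-1 : ℝ) • T).1 (b i) (b j) (b k) := fun i j => by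
      rw [hXb, (A + (-1 : ℝ) • T).2 (b j)]
      ring
    refine ⟨X, (hb.mem_so3_iff hadj hX).2 (by simpa only [hXb'] using R k), fun u w => ?_⟩
    refine sub_eq_zero.1 (skew_eq_zero_of_basis b
      (f := fun u w => (A + (-1 : ℝ) • T).1 u w (b k) - g u (X w))
      (fun w => ⟨fun x y => by simp only [map_add, LinearMap.add_apply, add_apply]; ring,
        fun c x => by
          simp only [map_smul, LinearMap.smul_apply, smul_apply, smul_eq_mul]; ring⟩)
      (fun u w => ?_) (fun i j _ => ?_) u w)
    · rw [(A + (-1 : ℝ) • T).2 u, hb.symm w, hX]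
      ring
    · rw [hXb', sub_self]
  choose X hX hXv using hX
  refine ⟨∑ k, b.repr v k • X k, Submodule.sum_mem _ fun k _ => Submodule.smul_mem _ _ (hX k),
    fun u w => ?_⟩
  conv_lhs => rw [← b.sum_repr v]
  simp only [map_sum, map_smul, hXv, LinearMap.sum_apply, LinearMap.smul_apply]

end IsAdapted
end AdaptedBasis

/-! ### Polarization of symmetric forms -/

section Polarization

variable {V : Type*} [AddCommGroup V] [Module ℝ V]

lemma symm_eq_zero_of_diagonal {f : V → V → V → ℝ}
    (hf : ∀ v w, IsLinearMap ℝ fun u => f u v w) (h₁₂ : ∀ u v w, f u v w = f v u w)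
    (h₂₃ : ∀ u v w, f u v w = f u w v) (h : ∀ v, f v v v = 0) (u v w : V) : f u v w = 0 := by
  have a1 : ∀ u u' v w, f (u + u') v w = f u v w + f u' v w := fun u u' v w => (hf v w).map_add u u'
  have a2 : ∀ u v v' w, f u (v + v') w = f u v w + f u v' w := fun u v v' w => by
    rw [h₁₂, a1, h₁₂ v, h₁₂ v']
  have a3 : ∀ u v w w', f u v (w + w') = f u v w + f u v w' := fun u v w w' => by
    rw [h₂₃, a2, h₂₃ u w, h₂₃ u w']
  have n1 : ∀ u v w, f (-u) v w = -f u v w := fun u v w => (hf v w).map_neg u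
  have n2 : ∀ u v w, f u (-v) w = -f u v w := fun u v w => by rw [h₁₂, n1, h₁₂]
  have n3 : ∀ u v w, f u v (-w) = -f u v w := fun u v w => by rw [h₂₃, n2, h₂₃]
  have key : ∀ u v, f u v v = 0 := fun u v => by
    have h1 := h (u + v)
    have h2 := h (u + -v)
    have h3 : f v v u = f u v v := by rw [h₂₃, h₁₂]
    simp only [a1, a2, a3, n1, n2, n3, h, h₁₂ v u, h₂₃ u v u, h3] at h1 h2
    linarith
  have h3 := key u (v + w)
  rw [a2, a3, a3, key, key, h₂₃ u w v] at h3
  linarith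

lemma symm_four_eq_zero_of_diagonal {f : V → V → V → V → ℝ}
    (hf : ∀ v w z, IsLinearMap ℝ fun u => f u v w z)
    (h₁₂ : ∀ u v w z, f u v w z = f v u w z) (h₂₃ : ∀ u v w z, f u v w z = f u w v z)
    (h₃₄ : ∀ u v w z, f u v w z = f u v z w) (h : ∀ v, f v v v v = 0) (u v w z : V) :
    f u v w z = 0 := by
  have a1 : ∀ u u' v w z, f (u + u') v w z = f u v w z + f u' v w z :=
    fun u u' v w z => (hf v w z).map_add u u'
  have m1 : ∀ (c : ℝ) u v w z, f (c • u) v w z = c * f u v w z :=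
    fun c u v w z => (hf v w z).map_smul c u
  have a2 : ∀ u v v' w z, f u (v + v') w z = f u v w z + f u v' w z := fun u v v' w z => by
    rw [h₁₂, a1, h₁₂ v, h₁₂ v']
  have m2 : ∀ (c : ℝ) u v w z, f u (c • v) w z = c * f u v w z := fun c u v w z => by
    rw [h₁₂, m1, h₁₂]
  have a3 : ∀ u v w w' z, f u v (w + w') z = f u v w z + f u v w' z := fun u v w w' z => by
    rw [h₂₃, a2, h₂₃ u w, h₂₃ u w']
  have m3 : ∀ (c : ℝ) u v w z, f u v (c • w) z = c * f u v w z := fun c u v w z => by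
    rw [h₂₃, m2, h₂₃]
  have a4 : ∀ u v w z z', f u v w (z + z') = f u v w z + f u v w z' := fun u v w z z' => by
    rw [h₃₄, a3, h₃₄ u v z, h₃₄ u v z']
  have m4 : ∀ (c : ℝ) u v w z, f u v w (c • z) = c * f u v w z := fun c u v w z => by
    rw [h₃₄, m3, h₃₄]
  -- The quartic polynomial `f (v + t u, …)` in `t` vanishes, so its coefficients do
  have key : ∀ u v, f u v v v = 0 := fun u v => by
    have e1 : f v u v v = f u v v v := h₁₂ _ _ _ _
    have e2 : f v v u v = f u v v v := by rw [h₂₃, e1]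
    have e3 : f v v v u = f u v v v := by rw [h₃₄, e2]
    have d1 : f u u v v = f v v u u := by rw [h₂₃, h₁₂, h₃₄, h₂₃]
    have d2 : f u v u v = f v v u u := by rw [h₁₂, h₃₄, h₂₃]
    have d3 : f u v v u = f v v u u := by rw [h₁₂, h₂₃]
    have d4 : f v u u v = f v v u u := by rw [h₃₄, h₂₃]
    have d5 : f v u v u = f v v u u := by rw [h₂₃]
    have c1 : f u v u u = f v u u u := h₁₂ _ _ _ _
    have c2 : f u u v u = f v u u u := by rw [h₂₃, c1]
    have c3 : f u u u v = f v u u u := by rw [h₃₄, c2]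
    have h1 := h (v + (1 : ℝ) • u)
    have h2 := h (v + (-1 : ℝ) • u)
    have h3 := h (v + (2 : ℝ) • u)
    simp only [a1, a2, a3, a4, m1, m2, m3, m4, h, e1, e2, e3, d1, d2, d3, d4, d5, c1, c2, c3]
      at h1 h2 h3
    linarith
  refine symm_eq_zero_of_diagonal (f := fun v w z => f u v w z)
    (fun w z => ⟨fun x y => a2 _ _ _ _ _, fun c x => m2 _ _ _ _ _⟩) (h₂₃ u) (h₃₄ u) (key u) v w z

end Polarization

/-! ### Infinitesimal deformations of `Υ` -/

section AdaptedBasis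

variable {V : Type*} [AddCommGroup V] [Module ℝ V] [TopologicalSpace V]
  [IsTopologicalAddGroup V] [ContinuousSMul ℝ V]
  {g : V →L[ℝ] V →L[ℝ] ℝ} {Υ : V →L[ℝ] V →L[ℝ] V} {b : Module.Basis (Fin 5) ℝ V}

/-- For `so(3) ⊗ V` the value of `Υ'` is a sum of
derivatives of the form of `Υ`, for `Λ³V` the summands cancel in pairs. -/
lemma sup_le_ker (hcomm : ∀ u v, Υ u v = Υ v u)
    (hadj : ∀ u v w, g u (Υ v w) = g w (Υ v u)) (hsymm : ∀ u v, g u v = g v u) :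
    so3Tensor g Υ ⊔ lambdaThree V ≤ LinearMap.ker (upsilonPrime Υ) := by
  refine sup_le (fun A hA => ?_) (fun A hA => ?_)
  · have key : ∀ u v w a, A.1 (Υ v w) u a + A.1 (Υ u w) v a + A.1 (Υ u v) w a = 0 := by
      intro u v w a
      obtain ⟨X, hX, hAX⟩ := hA a
      have h := hX.2 u v w
      rw [form_deriv_eq hcomm hadj, hsymm _ (Υ v w), hsymm _ (Υ u w), hsymm _ (Υ u v)] at h
      simpa only [hAX] using h
    rw [LinearMap.mem_ker]
    funext i j k l
    simp only [upsilonPrime, LinearMap.coe_mk, AddHom.coe_mk, Pi.zero_apply]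
    linear_combination key j k l i + key i k l j + key i j l k + key i j k l
  · rw [LinearMap.mem_ker]
    funext i j k l
    simp only [upsilonPrime, LinearMap.coe_mk, AddHom.coe_mk, Pi.zero_apply]
    linear_combination hA (Υ k l) j i + hA (Υ j l) k i + hA (Υ j k) l i + hA (Υ i l) k j +
      hA (Υ i k) l j + hA (Υ i j) l k

namespace IsAdapted

set_option maxHeartbeats 800000 in
/-- An infinitesimal deformation of `Υ` through symmetric tensors satisfying `Υ_v² v = g (v, v) v`
is the action of a skew endomorphism: the deformations of `Υ` are tangent to its orbit under the
orthogonal group. -/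
lemma exists_skew_of_deformation (hb : IsAdapted g Υ b)
    (hadj : ∀ u v w, g u (Υ v w) = g w (Υ v u)) (C : V →ₗ[ℝ] V →ₗ[ℝ] V)
    (hC : ∀ u v, C u v = C v u) (hC' : ∀ u v w, g u (C v w) = g w (C v u))
    (hsq : ∀ v, C v (Υ v v) + Υ v (C v v) = 0) :
    ∃ X : V →ₗ[ℝ] V, (∀ u v, g (X u) v = -g u (X v)) ∧
      ∀ u v w, g w (C u v) = g (X u) (Υ v w) + g (X v) (Υ u w) + g (X w) (Υ u v) := by
  -- the polarisation of `hsq`, paired with `z`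
  have H' : ∀ z u v w : V, g z (C u (Υ v w)) + g z (C v (Υ u w)) + g z (C w (Υ u v)) +
      (g (Υ u z) (C v w) + g (Υ v z) (C u w) + g (Υ w z) (C u v)) = 0 := fun z =>
    symm_eq_zero_of_diagonal
      (fun v w => ⟨fun x y => by simp only [map_add, add_apply, LinearMap.add_apply]; ring,
        fun c x => by
          simp only [map_smul, smul_apply, LinearMap.smul_apply, smul_eq_mul]; ring⟩)
      (fun u v w => by rw [hb.comm u v, hC u v]; ring)
      (fun u v w => by rw [hb.comm v w, hC v w]; ring) (fun v => by
        have h := congrArg (g z) (hsq v)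
        rw [map_add, map_zero, hadj, hb.symm _ (Υ v z)] at h
        linarith)
  obtain ⟨c, hcC⟩ : ∃ c : Fin 5 → Fin 5 → Fin 5 → ℝ,
      ∀ i j k, g (b i) (C (b j) (b k)) = c i j k := ⟨_, fun _ _ _ => rfl⟩
  have s12 : ∀ i j k, i < j → c j i k = c i j k := fun i j k _ => by
    rw [← hcC, ← hcC, hC, hC', hC]
  have s23 : ∀ i j k, j < k → c i k j = c i j k := fun i j k _ => by
    rw [← hcC, ← hcC, hC]
  have hΥ : ∀ i j, i < j → Υ (b j) (b i) = Υ (b i) (b j) := fun i j _ => hb.comm _ _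
  have H := fun i j k l => H' (b l) (b i) (b j) (b k)
  have h0000 := H 0 0 0 0
  have h0003 := H 0 0 0 3
  have h0004 := H 0 0 0 4
  have h0012 := H 0 0 1 2
  have h0033 := H 0 0 3 3
  have h0034 := H 0 0 3 4
  have h0044 := H 0 0 4 4
  have h0110 := H 0 1 1 0
  have h0111 := H 0 1 1 1
  have h0112 := H 0 1 1 2
  have h0122 := H 0 1 2 2
  have h0123 := H 0 1 2 3
  have h0124 := H 0 1 2 4
  have h0130 := H 0 1 3 0
  have h0140 := H 0 1 4 0
  have h0222 := H 0 2 2 2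
  have h0333 := H 0 3 3 3
  have h0444 := H 0 4 4 4
  have h1111 := H 1 1 1 1
  have h1113 := H 1 1 1 3
  have h1114 := H 1 1 1 4
  have h1133 := H 1 1 3 3
  have h1144 := H 1 1 4 4
  have h2222 := H 2 2 2 2
  have h2223 := H 2 2 2 3
  have h2224 := H 2 2 2 4
  have h2233 := H 2 2 3 3
  have h2333 := H 2 3 3 3
  have h2340 := H 2 3 4 0
  have h2341 := H 2 3 4 1
  have h2444 := H 2 4 4 4
  have h3333 := H 3 3 3 3
  have h3334 := H 3 3 3 4
  have h3344 := H 3 3 4 4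
  have h3444 := H 3 4 4 4
  simp only [hb.mul, map_add, map_sub, map_neg, map_zero, map_smul, smul_eq_mul, hcC, hΥ, s12, s23,
    add_apply, sub_apply, neg_apply, zero_apply, smul_apply, Fin.reduceLT]
    at h0000 h0003 h0004 h0012 h0033 h0034 h0044 h0110 h0111 h0112 h0122 h0123 h0124 h0130 h0140
      h0222 h0333 h0444 h1111 h1113 h1114 h1133 h1144 h2222 h2223 h2224 h2233 h2333 h2340 h2341
      h2444 h3333 h3334 h3344 h3444
  -- Of the 35 coefficients of `C`, the equations leave seven free, the codimension of `so(3)` in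
  -- `so(5)`.
  have t000 : c 0 0 0 = 0 := by linear_combination 1 / 6 * h0000
  have t003 : c 0 0 3 = 0 := by linear_combination 2 / 9 * h0003
  have t004 : c 0 0 4 = 0 := by linear_combination 2 / 9 * h0004
  have t011 : c 0 1 1 = 0 := by linear_combination -1 / 18 * h1111
  have t012 : c 0 1 2 = 0 := by linear_combination -1 / 3 * h0012
  have t022 : c 0 2 2 = 0 := by linear_combination -1 / 18 * h2222
  have t033 : c 0 3 3 = -1 / 3 * c 0 0 1 := by linear_combination 1 / 3 * h0033 - 1 / 18 * h0000
  have t034 : c 0 3 4 = -1 / 3 * c 0 0 2 := by linear_combination 1 / 3 * h0034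
  have t044 : c 0 4 4 = 1 / 3 * c 0 0 1 := by linear_combination 1 / 3 * h0044 - 1 / 18 * h0000
  have t111 : c 1 1 1 = -3 * c 0 0 1 := by linear_combination -1 / 3 * h0111
  have t112 : c 1 1 2 = -c 0 0 2 := by linear_combination -1 / 3 * h0112
  have t113 : c 1 1 3 = 2 * c 0 1 3 := by linear_combination 2 / 9 * h1113
  have t114 : c 1 1 4 = -2 * c 0 1 4 := by linear_combination -2 / 9 * h1114
  have t122 : c 1 2 2 = -c 0 0 1 := by linear_combination -1 / 3 * h0122
  have t123 : c 1 2 3 = c 0 1 4 + c 0 2 3 := by linear_combination -2 / 3 * h0123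
  have t124 : c 1 2 4 = c 0 1 3 - c 0 2 4 := by linear_combination -2 / 3 * h0124
  have t133 : c 1 3 3 = 1 / 3 * c 0 0 1 := by
    linear_combination 1 / 6 * h0033 + 1 / 18 * h0110 + 1 / 18 * h0111 + 1 / 6 * h1133
  have t144 : c 1 4 4 = 1 / 3 * c 0 0 1 := by
    linear_combination -1 / 6 * h0044 - 1 / 18 * h0110 + 1 / 18 * h0111 - 1 / 6 * h1144
  have t222 : c 2 2 2 = -3 * c 0 0 2 := by linear_combination -1 / 3 * h0222
  have t223 : c 2 2 3 = 2 * c 0 2 4 := by linear_combination 2 / 9 * h2224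
  have t224 : c 2 2 4 = 2 * c 0 2 3 := by linear_combination 2 / 9 * h2223
  have t233 : c 2 3 3 = 1 / 3 * c 0 0 2 - c 1 3 4 := by
    linear_combination -1 / 3 * h0034 + 1 / 3 * h3334
  have t234 : c 2 3 4 = 0 := by
    linear_combination 1 / 12 * h2233 - 1 / 12 * h2340 - 1 / 12 * h2341 + 1 / 24 * h3333 +
      1 / 8 * h3344
  have t244 : c 2 4 4 = 1 / 3 * c 0 0 2 + c 1 3 4 := by
    linear_combination -1 / 3 * h0034 + 1 / 3 * h3444
  have t333 : c 3 3 3 = -2 * c 0 1 3 := by linear_combination -4 / 3 * h0130 + 2 / 3 * h0333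
  have t334 : c 3 3 4 = -4 / 3 * c 0 2 3 - 2 / 3 * c 0 1 4 := by
    linear_combination 4 / 9 * h0123 + 2 / 9 * h2333
  have t344 : c 3 4 4 = 2 / 3 * c 0 1 3 - 4 / 3 * c 0 2 4 := by
    linear_combination -4 / 9 * h0124 + 2 / 9 * h2444
  have t444 : c 4 4 4 = 2 * c 0 1 4 := by linear_combination 4 / 3 * h0140 + 2 / 3 * h0444
  clear H H' h0000 h0003 h0004 h0012 h0033 h0034 h0044 h0110 h0111 h0112 h0122 h0123 h0124 h0130
    h0140 h0222 h0333 h0444 h1111 h1113 h1114 h1133 h1144 h2222 h2223 h2224 h2233 h2333 h2340 h2341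
    h2444 h3333 h3334 h3344 h3444
  -- `X` is unique modulo `so(3)`, and is normalised by vanishing at the positions `(0, 3)`,
  -- `(0, 4)` and `(3, 4)`, which parametrise `so(3)`.
  obtain ⟨X, hX, hXb⟩ := hb.exists_skew fun i j =>
    if (i, j) = (0, 1) then c 0 0 1 / 3 else if (i, j) = (0, 2) then c 0 0 2 / 3
    else if (i, j) = (1, 2) then -c 1 3 4 else if (i, j) = (1, 3) then -2 / 3 * c 0 1 3
    else if (i, j) = (1, 4) then -2 / 3 * c 0 1 4 else if (i, j) = (2, 3) then -2 / 3 * c 0 2 3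
    else if (i, j) = (2, 4) then -2 / 3 * c 0 2 4 else 0
  refine ⟨X, hX, fun u v w => sub_eq_zero.1 ?_⟩
  refine symm_eq_zero_of_basis b
    (f := fun u v w => g w (C u v) - (g (X u) (Υ v w) + g (X v) (Υ u w) + g (X w) (Υ u v)))
    (fun v w => ⟨fun x y => by simp only [map_add, add_apply, LinearMap.add_apply]; ring,
      fun c x => by simp only [map_smul, smul_apply, LinearMap.smul_apply, smul_eq_mul]; ring⟩)
    (fun u v w => by rw [hb.comm u v, hC u v]; ring)
    (fun u v w => by rw [hb.comm v w, hC' w u v]; ring) (fun i j k hij hjk => ?_) u v w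
  rw [show g (b k) (C (b i) (b j)) = c i j k by rw [hC', hC, hC', hC, hcC]]
  simp only [hX]
  fin_cases i <;> fin_cases j <;> first
    | exact absurd hij (by decide)
    | (clear hij
       fin_cases k <;> first
        | exact absurd hjk (by decide)
        | (simp only [Fin.reduceFinMk, Fin.zero_eta, Fin.mk_one, hb.mul, map_add, map_sub,
            map_neg, map_zero, map_smul, smul_eq_mul, hXb, Prod.mk.injEq, Fin.reduceEq, if_true,
            if_false, and_true, and_false, and_self, Fin.isValue, zero_ne_one, one_ne_zero,
            t000, t003, t004, t011, t012, t022, t033, t034, t044, t111, t112, t113, t114, t122,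
            t123, t124, t133, t144, t222, t223, t224, t233, t234, t244, t333, t334, t344, t444]
           ring))

end IsAdapted
end AdaptedBasis

section AdaptedBasis

variable {V : Type*} [AddCommGroup V] [Module ℝ V] [TopologicalSpace V]
  [IsTopologicalAddGroup V] [ContinuousSMul ℝ V]
  {g : V →L[ℝ] V →L[ℝ] ℝ} {Υ : V →L[ℝ] V →L[ℝ] V} {b : Module.Basis (Fin 5) ℝ V}

/-- The pointwise form of the existence of a characteristic connection. Here `C w u v` stands for
`(∇_w Υ)(u, v)`, with `∇` the Levi-Civita connection, and `A u w` for `A_w u`, with `A` the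
difference of the two connections; the symmetry conditions on `A` say that `g (A_w u, v)` is totally
skew, and the last equation that `Υ` is parallel for `∇ + A`. -/
lemma IsAdapted.exists_correction (hb : IsAdapted g Υ b)
    (hadj : ∀ u v w, g u (Υ v w) = g w (Υ v u)) (hpos : ∀ v, v ≠ 0 → 0 < g v v)
    (C : V → V →ₗ[ℝ] V →ₗ[ℝ] V) (hlin : ∀ u v, IsLinearMap ℝ fun w => C w u v)
    (hC : ∀ w u v, C w u v = C w v u) (hC' : ∀ a u v w, g u (C a v w) = g w (C a v u))
    (hsq : ∀ w v, C w v (Υ v v) + Υ v (C w v v) = 0) (hni : ∀ v, g v (C v v v) = 0) :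
    ∃ A : V →ₗ[ℝ] V →ₗ[ℝ] V, (∀ u v w, g (A u w) v = -g u (A v w)) ∧
      (∀ u w, A u w = -A w u) ∧
      ∀ w u v, C w u v + A (Υ u v) w - Υ (A u w) v - Υ u (A v w) = 0 := by
  choose X hX hXC using fun w => hb.exists_skew_of_deformation hadj (C w) (hC w) (hC' w) (hsq w)
  -- `X w` is unique only modulo `so(3)`; the values at a basis are extended linearly in `w`.
  let Z : V →ₗ[ℝ] V →ₗ[ℝ] V := b.constr ℝ fun k => X (b k)
  have hZ : ∀ w, Z w = ∑ k, b.repr w k • X (b k) := fun w => by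
    simp [Z, Module.Basis.constr_apply_fintype]
  have hZskew : ∀ w u v, g (Z w u) v = -g u (Z w v) := fun w u v => by
    simp only [hZ, LinearMap.sum_apply, LinearMap.smul_apply, map_sum, map_smul, sum_apply,
      smul_apply, hX, ← Finset.sum_neg_distrib, smul_neg]
  have hZC : ∀ a u v w, g w (C a u v) =
      g (Z a u) (Υ v w) + g (Z a v) (Υ u w) + g (Z a w) (Υ u v) := fun a u v w => by
    refine sub_eq_zero.1 (linear_eq_zero_of_basis b (f := fun a => g w (C a u v) -
      (g (Z a u) (Υ v w) + g (Z a v) (Υ u w) + g (Z a w) (Υ u v)))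
      ⟨fun x y => by
        simp only [(hlin u v).map_add, map_add, add_apply, LinearMap.add_apply]; ring,
        fun c x => by
        simp only [(hlin u v).map_smul, map_smul, smul_apply, LinearMap.smul_apply, smul_eq_mul]
        ring⟩ (fun k => ?_) a)
    simp only [Z, Module.Basis.constr_basis, hXC, sub_self]
  let gl : V →ₗ[ℝ] V →ₗ[ℝ] ℝ := LinearMap.mk₂ ℝ (fun u v => g u v) (by simp) (by simp) (by simp)
    (by simp)
  let B : lambdaTwoTensor V := ⟨LinearMap.mk₂ ℝ (fun u v => gl u ∘ₗ Z.flip v)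
    (fun u u' v => by ext; simp) (fun c u v => by ext; simp) (fun u v v' => by ext; simp)
    (fun c u v => by ext; simp), fun u v w => by
      change g u (Z w v) = -g v (Z w u)
      rw [hb.symm v, hZskew]; ring⟩
  have hB : ∀ u v w, B.1 u v w = g u (Z w v) := fun _ _ _ => rfl
  -- `Υ' (B)` is a symmetric quartic form whose diagonal is a multiple of `g (v, C_v (v, v)) = 0`.
  have hBker : B ∈ LinearMap.ker (upsilonPrime Υ) := by
    rw [LinearMap.mem_ker]
    funext i j k l
    refine symm_four_eq_zero_of_diagonal (f := upsilonPrime Υ B) (fun v w z => ⟨fun x y => ?_,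
      fun c x => ?_⟩) (fun u v w z => ?_) (fun u v w z => ?_) (fun u v w z => ?_) (fun v => ?_)
      i j k l <;>
    simp only [upsilonPrime, LinearMap.coe_mk, AddHom.coe_mk]
    · simp only [map_add, add_apply, LinearMap.add_apply]; ring
    · simp only [map_smul, smul_apply, LinearMap.smul_apply, smul_eq_mul]; ring
    · rw [hb.comm v u]; ring
    · rw [hb.comm w v]; ring
    · rw [hb.comm w z]; ring
    · have h1 := hni v
      rw [hZC, hb.symm (Z v v)] at h1
      simp only [hB]
      linarith
  -- The part of `Z` in `so(3) ⊗ V` does not act on `Υ`; the correction is its part in `Λ³V`.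
  obtain ⟨S, hS, T, hT, hST⟩ := Submodule.mem_sup.1 (hb.ker_le hadj hBker)
  choose Y hY hYS using hS
  have hTg : ∀ u v w, g u (Z w v - Y w v) = T.1 u v w := fun u v w => by
    rw [map_sub, ← hB, ← hST, ← hYS]
    simp
  let A : V →ₗ[ℝ] V →ₗ[ℝ] V := LinearMap.mk₂ ℝ (fun v w => Z w v - Y w v)
    (fun v v' w => eq_of_forall_inner_eq hpos fun u => by rw [map_add (g u)]; simp only [hTg]; simp)
    (fun c v w => eq_of_forall_inner_eq hpos fun u => by rw [map_smul (g u)]; simp only [hTg]; simp)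
    (fun v w w' => eq_of_forall_inner_eq hpos fun u => by rw [map_add (g u)]; simp only [hTg]; simp)
    (fun c v w => eq_of_forall_inner_eq hpos fun u => by rw [map_smul (g u)]; simp only [hTg]; simp)
  have hA : ∀ u v w, g u (A v w) = T.1 u v w := hTg
  refine ⟨A, fun u v w => ?_, fun u w => eq_of_forall_inner_eq hpos fun z => ?_, fun w u v =>
    eq_of_forall_inner_eq hpos fun z => ?_⟩
  · rw [hb.symm, hA, hA, T.2]
  · rw [map_neg, hA, hA, hT]
  · have h1 := (hY w).2 u v z
    rw [form_deriv_eq hb.comm hadj] at h1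
    have h2 : ∀ u v, g (Y w u) v = -g u (Y w v) := (hY w).1
    have h3 : ∀ u v, g u (A v w) = g u (Z w v) - g u (Y w v) := fun u v => by
      rw [← map_sub]; rfl
    have h4 : ∀ u v z, g z (Υ u (A v w)) = g (A v w) (Υ u z) := fun u v z => hadj _ _ _
    rw [map_sub, map_sub, map_add, hb.comm (A u w) v, h4, h4, hZC, map_zero, hb.symm (A u w),
      hb.symm (A v w), h3, h3, h3]
    rw [h2 z] at h1
    rw [hZskew w z]
    rw [hb.symm (Y w u), hb.symm (Y w v)] at h1
    rw [hb.symm (Z w u), hb.symm (Z w v)]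
    linarith

end AdaptedBasis

/-! ### Smooth sections of vector bundles -/

section Bundle

variable {E : Type*} [NormedAddCommGroup E] [NormedSpace ℝ E]
  {H : Type*} [TopologicalSpace H] {I : ModelWithCorners ℝ E H}
  {M : Type*} [TopologicalSpace M] [ChartedSpace H M]
  {F : Type*} [NormedAddCommGroup F] [NormedSpace ℝ F]
  {V : M → Type*} [TopologicalSpace (TotalSpace F V)]
  [∀ x, AddCommGroup (V x)] [∀ x, Module ℝ (V x)] [∀ x, TopologicalSpace (V x)]
  [FiberBundle F V] [VectorBundle ℝ F V]

lemma exists_contMDiff_section [FiniteDimensional ℝ E] [T2Space M] [IsManifold I ∞ M]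
    [ContMDiffVectorBundle ∞ F V I] {x₀ : M} (v : V x₀) :
    ∃ σ : Π x, V x, σ x₀ = v ∧
      ContMDiff I (I.prod 𝓘(ℝ, F)) ∞ (fun x => TotalSpace.mk' F x (σ x)) := by
  obtain ⟨u, hu, hs⟩ := FiberBundle.exists_contMDiffOn_extend I F (k := ∞) v
  obtain ⟨u', hu', huo, hxu⟩ := mem_nhds_iff.1 hu
  obtain ⟨ψ, -, hψ⟩ := (SmoothBumpFunction.nhds_basis_tsupport (I := I) x₀).mem_iff.1
    (huo.mem_nhds hxu)
  refine ⟨(ψ : M → ℝ) • FiberBundle.extend F v, by simp, ?_⟩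
  exact ContMDiffOn.smul_section_of_tsupport ψ.contMDiff.contMDiffOn huo hψ (hs.mono hu')

/-- A section of a vector bundle is smooth if sufficiently many functions obtained from it by
smooth fibrewise linear functionals are smooth. In a local frame, the coefficients of the section
solve a linear system with smooth coefficients whose matrix is injective at `x₀`; a left
inverse of the matrix at `x₀` turns it into an invertible system. -/
lemma contMDiffAt_section_of_functionals [FiniteDimensional ℝ F] {n : ℕ∞ω}
    [ContMDiffVectorBundle 1 F V I] [ContMDiffVectorBundle n F V I]
    {J : Type*} [Fintype J] {x₀ : M} (l : J → Π x, V x → ℝ)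
    (hlin : ∀ j x, IsLinearMap ℝ (l j x))
    (hsmooth : ∀ j (σ : Π x, V x),
      ContMDiffAt I (I.prod 𝓘(ℝ, F)) n (fun x => TotalSpace.mk' F x (σ x)) x₀ →
        ContMDiffAt I 𝓘(ℝ, ℝ) n (fun x => l j x (σ x)) x₀)
    (hinj : ∀ v : V x₀, (∀ j, l j x₀ v = 0) → v = 0) (A : Π x, V x)
    (hA : ∀ j, ContMDiffAt I 𝓘(ℝ, ℝ) n (fun x => l j x (A x)) x₀) :
    ContMDiffAt I (I.prod 𝓘(ℝ, F)) n (fun x => TotalSpace.mk' F x (A x)) x₀ := by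
  set e := trivializationAt F V x₀
  have he : x₀ ∈ e.baseSet := FiberBundle.mem_baseSet_trivializationAt' x₀
  let b := Module.finBasis ℝ F
  let s := e.localFrame b
  let c := fun i x => e.localFrameCoeff I b i x (A x)
  -- `L x` reads off the values of the functionals on the section with given frame coefficients
  let L : M → F →L[ℝ] (J → ℝ) := fun x =>
    ∑ i, (b.coord i).toContinuousLinearMap.smulRight (fun j => l j x (s i x))
  have hLapp : ∀ x ∈ e.baseSet, ∀ f : F, ∀ j, L x f j = l j x (∑ i, b.repr f i • s i x) := by
    intro x _ f j
    let lj := (hlin j x).mk' (l j x)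
    change _ = lj _
    simp only [L, lj, FunLike.coe_sum, Finset.sum_apply, map_sum, map_smul,
      ContinuousLinearMap.smulRight_apply, Pi.smul_apply, LinearMap.coe_toContinuousLinearMap',
      Module.Basis.coord_apply, IsLinearMap.mk'_apply]
  have hL : ContMDiffAt I 𝓘(ℝ, F →L[ℝ] (J → ℝ)) n L x₀ := by
    refine ContMDiffAt.sum fun i _ => ?_
    exact (ContinuousLinearMap.smulRightL ℝ F (J → ℝ)
      (b.coord i).toContinuousLinearMap).contMDiff.contMDiffAt.comp x₀
      (contMDiffAt_pi_space.2 fun j => hsmooth j _ (contMDiffAt_localFrame_of_mem n e b i he))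
  have hLinj : LinearMap.ker (L x₀ : F →ₗ[ℝ] (J → ℝ)) = ⊥ := by
    rw [LinearMap.ker_eq_bot']
    intro f hf
    have h1 : ∑ i, b.repr f i • s i x₀ = 0 := hinj _ fun j => by
      rw [← hLapp x₀ he]
      exact congrFun hf j
    have h2 := Fintype.linearIndependent_iff.1 (e.basisAt b he).linearIndependent (b.repr f) (by
      simpa only [s, e.localFrame_apply_of_mem_baseSet b he] using h1)
    exact b.repr.map_eq_zero_iff.1 (Finsupp.ext h2)
  obtain ⟨Q, hQ⟩ := (L x₀ : F →ₗ[ℝ] (J → ℝ)).exists_leftInverse_of_injective hLinj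
  let Q' : (J → ℝ) →L[ℝ] F := Q.toContinuousLinearMap
  let G : M → F →L[ℝ] F := fun x => Q' ∘L L x
  have hG : ContMDiffAt I 𝓘(ℝ, F →L[ℝ] F) n G x₀ :=
    contMDiffAt_const.clm_comp hL
  have hG0 : G x₀ = 1 := by
    ext f
    exact LinearMap.congr_fun hQ f
  let y : M → F := fun x => Q' fun j => l j x (A x)
  have hy : ContMDiffAt I 𝓘(ℝ, F) n y x₀ :=
    Q'.contMDiff.contMDiffAt.comp x₀ (contMDiffAt_pi_space.2 hA)
  have hinv : ContMDiffAt I 𝓘(ℝ, F →L[ℝ] F) n (fun x => Ring.inverse (G x)) x₀ := by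
    have := contDiffAt_ringInverse ℝ (n := n) (1 : (F →L[ℝ] F)ˣ)
    rw [Units.val_one, ← hG0] at this
    exact this.contMDiffAt.comp x₀ hG
  have ha : ∀ᶠ x in nhds x₀, ∑ i, c i x • b i = Ring.inverse (G x) (y x) := by
    have hunit : ∀ᶠ x in nhds x₀, IsUnit (G x) := by
      refine hG.continuousAt.eventually_mem (Units.isOpen.mem_nhds ?_)
      rw [hG0]
      exact isUnit_one
    filter_upwards [hunit, e.open_baseSet.mem_nhds he] with x hx hxe
    have h1 : G x (∑ i, c i x • b i) = y x := by
      change Q' (L x _) = Q' _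
      congr 1
      ext j
      rw [hLapp x hxe, e.eq_sum_localFrameCoeff_smul (I := I) (s := A) (b := b) hxe]
      congr 1
      refine Finset.sum_congr rfl fun i _ => ?_
      simp [c, s, Finsupp.single_apply]
    rw [← h1, ← mul_apply_eq_comp, Ring.inverse_mul_cancel _ hx]
    rfl
  rw [contMDiffAt_iff_localFrameCoeff b he]
  intro i
  have h2 : ContMDiffAt I 𝓘(ℝ, ℝ) n (fun x => b.coord i (Ring.inverse (G x) (y x))) x₀ :=
    (b.coord i).toContinuousLinearMap.contMDiff.contMDiffAt.comp x₀ (hinv.clm_apply hy)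
  refine h2.congr_of_eventuallyEq ?_
  filter_upwards [ha] with x hx
  rw [← hx, Module.Basis.coord_apply, b.repr_sum_self]
  rfl

end Bundle

/-! ### Covariant derivatives of `Υ` and the torsion -/

section Manifold

variable {E : Type*} [NormedAddCommGroup E] [NormedSpace ℝ E]
  {H : Type*} [TopologicalSpace H] {I : ModelWithCorners ℝ E H}
  {M : Type*} [TopologicalSpace M] [ChartedSpace H M] [IsManifold I ∞ M]
  {g : ContMDiffRiemannianMetric I ∞ E (TangentSpace I : M → Type _)}

lemma contMDiffAt_inner {X Y : ∀ x : M, TangentSpace I x} {x : M}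
    (hX : CMDiffAt ∞ (T% X) x) (hY : CMDiffAt ∞ (T% Y) x) :
    CMDiffAt ∞ (fun y => g.inner y (X y) (Y y)) x := by
  have h : ContMDiffAt I (I.prod 𝓘(ℝ, ℝ)) ∞
      (fun y => TotalSpace.mk' ℝ (E := Trivial M ℝ) y (g.inner y (X y) (Y y))) x :=
    ContMDiffAt.clm_bundle_apply₂ (F₁ := E) (F₂ := E) g.contMDiff.contMDiffAt hX hY
  simp only [contMDiffAt_totalSpace] at h
  exact h.2

lemma mdifferentiableAt_inner {X Y : ∀ x : M, TangentSpace I x} {x : M}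
    (hX : MDiffAt (T% X) x) (hY : MDiffAt (T% Y) x) :
    MDiffAt (fun y => g.inner y (X y) (Y y)) x := by
  have h : MDifferentiableAt I (I.prod 𝓘(ℝ, ℝ))
      (fun y => TotalSpace.mk' ℝ (E := Trivial M ℝ) y (g.inner y (X y) (Y y))) x :=
    MDifferentiableAt.clm_bundle_apply₂ (F₁ := E) (F₂ := E)
      (g.contMDiff.contMDiffAt.mdifferentiableAt (by simp)) hX hY
  simp only [mdifferentiableAt_totalSpace] at h
  exact h.2

namespace SO3Structure

variable (S : SO3Structure g)

lemma contMDiffAt_tensor {X Y : ∀ x : M, TangentSpace I x} {x : M}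
    (hX : CMDiffAt ∞ (T% X) x) (hY : CMDiffAt ∞ (T% Y) x) :
    CMDiffAt ∞ (T% fun y => S.tensor y (X y) (Y y)) x :=
  ContMDiffAt.clm_bundle_apply₂ (F₁ := E) (F₂ := E) S.contMDiff_tensor.contMDiffAt hX hY

lemma mdifferentiableAt_tensor {X Y : ∀ x : M, TangentSpace I x} {x : M}
    (hX : MDiffAt (T% X) x) (hY : MDiffAt (T% Y) x) :
    MDiffAt (T% fun y => S.tensor y (X y) (Y y)) x :=
  MDifferentiableAt.clm_bundle_apply₂ (F₁ := E) (F₂ := E)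
    (S.contMDiff_tensor.contMDiffAt.mdifferentiableAt (by simp)) hX hY

/-- `(D_w Υ)(X, Y)` for vector fields `X`, `Y`. -/
def covDerivField (D : Connection I M) (x : M) (w : TangentSpace I x)
    (X Y : ∀ x : M, TangentSpace I x) : TangentSpace I x :=
  D (fun y => S.tensor y (X y) (Y y)) x w - S.tensor x (D X x w) (Y x) - S.tensor x (X x) (D Y x w)

lemma tensorialAt_covDerivField_left (D : Connection I M) (x : M) (w : TangentSpace I x)
    (Y : ∀ x : M, TangentSpace I x) (hY : MDiffAt (T% Y) x) :
    TensorialAt I E (S.covDerivField D x w · Y) x where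
  smul {f X} hf hX := by
    have h : (fun y => S.tensor y ((f • X) y) (Y y)) = f • fun y => S.tensor y (X y) (Y y) := by
      funext y; simp
    simp only [covDerivField, h, D.isCovariantDerivativeOnUniv.leibniz hX hf,
      D.isCovariantDerivativeOnUniv.leibniz (S.mdifferentiableAt_tensor hX hY) hf]
    simp
    module
  add {X X'} hX hX' := by
    have h : (fun y => S.tensor y ((X + X') y) (Y y)) =
        (fun y => S.tensor y (X y) (Y y)) + fun y => S.tensor y (X' y) (Y y) := by
      funext y; simp
    simp only [covDerivField, h, D.isCovariantDerivativeOnUniv.add hX hX',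
      D.isCovariantDerivativeOnUniv.add (S.mdifferentiableAt_tensor hX hY)
        (S.mdifferentiableAt_tensor hX' hY)]
    simp
    module

lemma tensor_comm (x : M) (u v : TangentSpace I x) : S.tensor x u v = S.tensor x v u :=
  (S.isSO3Tensor x).comm (g.pos x) u v

lemma covDerivField_comm (D : Connection I M) (x : M) (w : TangentSpace I x)
    (X Y : ∀ x : M, TangentSpace I x) : S.covDerivField D x w X Y = S.covDerivField D x w Y X := by
  simp only [covDerivField, S.tensor_comm _ (X _), S.tensor_comm _ (D X _ _)]
  module

lemma tensorialAt_covDerivField_right (D : Connection I M) (x : M) (w : TangentSpace I x)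
    (X : ∀ x : M, TangentSpace I x) (hX : MDiffAt (T% X) x) :
    TensorialAt I E (S.covDerivField D x w X) x := by
  have h := S.tensorialAt_covDerivField_left D x w X hX
  simpa only [S.covDerivField_comm D x w _ X] using h

variable [FiniteDimensional ℝ E]

/-- The covariant derivative `D_w Υ` as a bilinear map on `T_x M`. -/
def covDeriv (D : Connection I M) (x : M) (w : TangentSpace I x) :
    TangentSpace I x →L[ℝ] TangentSpace I x →L[ℝ] TangentSpace I x :=
  TensorialAt.mkHom₂ (S.covDerivField D x w) x (S.tensorialAt_covDerivField_left D x w)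
    (S.tensorialAt_covDerivField_right D x w)

lemma covDeriv_apply (D : Connection I M) {x : M} (w : TangentSpace I x)
    {X Y : ∀ x : M, TangentSpace I x} (hX : MDiffAt (T% X) x) (hY : MDiffAt (T% Y) x) :
    S.covDeriv D x w (X x) (Y x) =
      D (fun y => S.tensor y (X y) (Y y)) x w - S.tensor x (D X x w) (Y x) -
        S.tensor x (X x) (D Y x w) :=
  TensorialAt.mkHom₂_apply _ _ hX hY

/-- The metric identifies the derivative of the cubic form of `Υ` with that of `Υ` as a bilinear
map. -/
lemma tensorDeriv_eq {D : Connection I M} (hD : IsMetric g D) {x : M} (w : TangentSpace I x)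
    {X Y Z : ∀ x : M, TangentSpace I x} (hX : MDiffAt (T% X) x) (hY : MDiffAt (T% Y) x)
    (hZ : MDiffAt (T% Z) x) :
    S.tensorDeriv D X Y Z x w = g.inner x (X x) (S.covDeriv D x w (Z x) (Y x)) := by
  have h := hD X (fun y => S.tensor y (Z y) (Y y)) x w hX (S.mdifferentiableAt_tensor hZ hY)
  simp only [tensorDeriv, form] at h ⊢
  rw [h, S.covDeriv_apply D w hZ hY, map_sub, map_sub]
  ring

section Pointwise

variable {D : Connection I M} {x : M} (w : TangentSpace I x)

open FiberBundle (extend)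

lemma covDeriv_comm (D : Connection I M) (u v : TangentSpace I x) :
    S.covDeriv D x w u v = S.covDeriv D x w v u := by
  have hu := FiberBundle.mdifferentiableAt_extend I E u
  have hv := FiberBundle.mdifferentiableAt_extend I E v
  have h1 := S.covDeriv_apply D w hu hv
  have h2 := S.covDeriv_apply D w hv hu
  simp only [FiberBundle.extend_apply_self] at h1 h2
  rw [h1, h2, S.tensor_comm x (D (extend E v) x w), S.tensor_comm x v (D (extend E u) x w),
    funext fun y => S.tensor_comm y (extend E u y) (extend E v y)]
  module

lemma covDeriv_symm (hD : IsMetric g D) (u v z : TangentSpace I x) :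
    g.inner x u (S.covDeriv D x w v z) = g.inner x z (S.covDeriv D x w v u) := by
  have hu := FiberBundle.mdifferentiableAt_extend I E u
  have hv := FiberBundle.mdifferentiableAt_extend I E v
  have hz := FiberBundle.mdifferentiableAt_extend I E z
  have h1 := S.tensorDeriv_eq hD w hu hz hv
  have h2 := S.tensorDeriv_eq hD w hz hu hv
  simp only [FiberBundle.extend_apply_self] at h1 h2
  rw [← h1, ← h2]
  simp only [tensorDeriv, form, (S.isSO3Tensor _).symm_left (extend E u _),
    (S.isSO3Tensor _).symm_left (D (extend E u) _ _)]
  ring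

/-- The derivative of the identity `Υ_v² v = g (v, v) v`. -/
lemma covDeriv_tensor_self (hD : IsMetric g D) (v : TangentSpace I x) :
    S.covDeriv D x w v (S.tensor x v v) + S.tensor x v (S.covDeriv D x w v v) = 0 := by
  set V := extend E v with hVdef
  have hV : MDiffAt (T% V) x := FiberBundle.mdifferentiableAt_extend I E v
  have hVv : V x = v := FiberBundle.extend_apply_self ..
  have hVV := S.mdifferentiableAt_tensor hV hV
  have h1 := S.covDeriv_apply D w hV hVV
  have h2 := S.covDeriv_apply D w hV hV
  have h3 : (fun y => S.tensor y (V y) (S.tensor y (V y) (V y))) =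
      (fun y => g.inner y (V y) (V y)) • V := by
    funext y
    exact (S.isSO3Tensor y).sq_apply (V y)
  have h4 := D.isCovariantDerivativeOnUniv.leibniz hV (mdifferentiableAt_inner (g := g) hV hV)
  have h5 := hD V V x w hV hV
  have h6 := (S.isSO3Tensor x).polarized (g.symm x) (g.pos x) (D V x w) v v
  rw [h3, h4] at h1
  simp only [add_apply, smul_apply, ContinuousLinearMap.smulRight_apply, h5] at h1
  simp only [hVv] at h1 h2
  rw [g.symm x v (D V x w)] at h1
  rw [h1, h2, map_sub, map_sub, S.tensor_comm x v (D V x w)]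
  linear_combination (norm := module) -h6

lemma isLinearMap_covDeriv (D : Connection I M) (u v : TangentSpace I x) :
    IsLinearMap ℝ fun w => S.covDeriv D x w u v := by
  have hu := FiberBundle.mdifferentiableAt_extend I E u
  have hv := FiberBundle.mdifferentiableAt_extend I E v
  have h1 := fun w => S.covDeriv_apply D w hu hv
  simp only [FiberBundle.extend_apply_self] at h1
  constructor
  · intro w w'
    simp only [h1, map_add, add_apply]
    module
  · intro c w
    simp only [h1, map_smul, smul_apply]
    module

lemma covDeriv_addOneForm (D : Connection I M)
    (A : ∀ x : M, TangentSpace I x →L[ℝ] TangentSpace I x →L[ℝ] TangentSpace I x)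
    (u v : TangentSpace I x) :
    S.covDeriv (D.addOneForm A) x w u v = S.covDeriv D x w u v + A x (S.tensor x u v) w -
      S.tensor x (A x u w) v - S.tensor x u (A x v w) := by
  have hu := FiberBundle.mdifferentiableAt_extend I E u
  have hv := FiberBundle.mdifferentiableAt_extend I E v
  have h1 := S.covDeriv_apply D w hu hv
  have h2 := S.covDeriv_apply (D.addOneForm A) w hu hv
  simp only [FiberBundle.extend_apply_self] at h1 h2
  rw [h1, h2]
  simp only [CovariantDerivative.addOneForm, add_apply, map_add, FiberBundle.extend_apply_self]
  module

end Pointwise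

end SO3Structure

lemma isMetric_addOneForm {D : Connection I M} (hD : IsMetric g D)
    {A : ∀ x : M, TangentSpace I x →L[ℝ] TangentSpace I x →L[ℝ] TangentSpace I x}
    (hA : ∀ x u v w, g.inner x (A x u w) v = -g.inner x u (A x v w)) :
    IsMetric g (D.addOneForm A) := by
  intro X Y x v hX hY
  rw [hD X Y x v hX hY]
  simp only [CovariantDerivative.addOneForm, add_apply, map_add, hA]
  ring

/-- Global smoothness of `Y` is assumed because smoothness of a connection is a statement about
global sections. -/
lemma contMDiffAt_connection_apply {D : Connection I M}
    (hD : CovariantDerivative.ContMDiffCovariantDerivative D ∞) {X Y : ∀ x : M, TangentSpace I x}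
    (hX : CMDiff ∞ (T% X)) (hY : CMDiff ∞ (T% Y)) (x : M) :
    CMDiffAt ∞ (T% fun y => D Y y (X y)) x := by
  have h := (hD.contMDiff.contMDiff (σ := Y) hY.contMDiffOn).contMDiffAt (x := x) (by simp)
  exact ContMDiffAt.clm_bundle_apply (F₁ := E) (F₂ := E) h hX.contMDiffAt

lemma contMDiffCovariantDerivative_addOneForm {D : Connection I M}
    (hD : CovariantDerivative.ContMDiffCovariantDerivative D ∞)
    {A : ∀ x : M, TangentSpace I x →L[ℝ] TangentSpace I x →L[ℝ] TangentSpace I x}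
    (hA : ContMDiff I (I.prod 𝓘(ℝ, E →L[ℝ] E →L[ℝ] E)) ∞
      (fun x => TotalSpace.mk' (E →L[ℝ] E →L[ℝ] E)
        (E := fun x : M => TangentSpace I x →L[ℝ] TangentSpace I x →L[ℝ] TangentSpace I x)
        x (A x))) :
    CovariantDerivative.ContMDiffCovariantDerivative (D.addOneForm A) ∞ := by
  refine ⟨⟨fun {σ} hσ => ?_⟩⟩
  have h1 := hD.contMDiff.contMDiff hσ
  have h2 : ContMDiffOn I (I.prod 𝓘(ℝ, E →L[ℝ] E)) ∞
      (fun x => TotalSpace.mk' (E →L[ℝ] E)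
        (E := fun x : M => TangentSpace I x →L[ℝ] TangentSpace I x) x (A x (σ x))) Set.univ :=
    ContMDiffOn.clm_bundle_apply (F₁ := E) (F₂ := E →L[ℝ] E) (b := id)
      (E₂ := fun x : M => TangentSpace I x →L[ℝ] TangentSpace I x) hA.contMDiffOn
      (by simpa using hσ)
  exact ContMDiffOn.add_section h1 h2

section Torsion

variable [FiniteDimensional ℝ E]

lemma torsion_apply (D : Connection I M) {x : M} {X Y : ∀ x : M, TangentSpace I x}
    (hX : MDiffAt (T% X) x) (hY : MDiffAt (T% Y) x) :
    torsion D x (X x) (Y x) = D Y x (X x) - D X x (Y x) - VectorField.mlieBracket I X Y x := by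
  have : CompleteSpace E := FiniteDimensional.complete ℝ E
  exact CovariantDerivative.torsion_apply D hX hY

lemma torsion_self (D : Connection I M) {x : M} (u : TangentSpace I x) : torsion D x u u = 0 := by
  have : CompleteSpace E := FiniteDimensional.complete ℝ E
  exact CovariantDerivative.torsion_self D u

lemma torsion_antisymm (D : Connection I M) {x : M} (u v : TangentSpace I x) :
    torsion D x u v = -torsion D x v u := by
  have : CompleteSpace E := FiniteDimensional.complete ℝ E
  exact CovariantDerivative.torsion_antisymm D u v

lemma torsion_addOneForm (D : Connection I M)
    (A : ∀ x : M, TangentSpace I x →L[ℝ] TangentSpace I x →L[ℝ] TangentSpace I x)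
    {x : M} (u v : TangentSpace I x) :
    torsion (D.addOneForm A) x u v = torsion D x u v + A x v u - A x u v := by
  have hu := FiberBundle.mdifferentiableAt_extend I E u
  have hv := FiberBundle.mdifferentiableAt_extend I E v
  have h1 := torsion_apply D hu hv
  have h2 := torsion_apply (D.addOneForm A) hu hv
  simp only [FiberBundle.extend_apply_self] at h1 h2
  rw [h1, h2]
  simp only [CovariantDerivative.addOneForm, add_apply, FiberBundle.extend_apply_self]
  module

end Torsion

end Manifold

/-! ### The intersection of `so(3) ⊗ V` and `Λ³V`, and smoothness -/

/-- A tensor in `Λ²V ⊗ V` whose skew part in the last two indices is totally skew is totally skew: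
the difference of two metric connections with totally skew torsion lies in `Λ³V`. -/
lemma skew_of_torsion_skew {V : Type*} {a : V → V → V → ℝ} (h : ∀ u v w, a u v w = -a v u w)
    (ht : ∀ u v w, a w v u - a w u v = -(a v w u - a v u w)) (u v w : V) :
    a u v w = -a u w v := by
  linarith [ht u v w, ht v w u, ht w u v, ht v u w, ht w v u, ht u w v, h u v w, h v w u, h w u v,
    h v u w]

section Algebra

variable {V : Type*} [AddCommGroup V] [Module ℝ V] [TopologicalSpace V]
  [IsTopologicalAddGroup V] [ContinuousSMul ℝ V] [Module.Finite ℝ V]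
  {g : V →L[ℝ] V →L[ℝ] ℝ} {Υ : V →L[ℝ] V →L[ℝ] V}

/-- An element of `[so(3) ⊗ V] ∩ Λ³V`, written as a family `w ↦ A_w` of endomorphisms with
`A u w = A_w u`, vanishes. -/
lemma IsSO3Tensor.eq_zero_of_skew (h : IsSO3Tensor g Υ) (hsymm : ∀ u v, g u v = g v u)
    (hpos : ∀ v, v ≠ 0 → 0 < g v v) (hdim : Module.finrank ℝ V = 5) (A : V →L[ℝ] V →L[ℝ] V)
    (hskew : ∀ u v w, g (A u w) v = -g u (A v w)) (hswap : ∀ u w, A u w = -A w u)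
    (hder : ∀ u v w, A (Υ u v) w = Υ (A u w) v + Υ u (A v w)) : A = 0 := by
  obtain ⟨b, hb⟩ := h.exists_isAdapted hsymm hpos hdim
  let B : lambdaTwoTensor V := ⟨LinearMap.mk₂ ℝ
    (fun u v => (g u : V →ₗ[ℝ] ℝ) ∘ₗ (A v : V →ₗ[ℝ] V)) (fun u u' v => by ext; simp)
    (fun c u v => by ext; simp) (fun u v v' => by ext; simp) (fun c u v => by ext; simp),
    fun u v w => by
      change g u (A v w) = -g v (A u w)
      rw [hsymm v, hskew, neg_neg]⟩
  have hB : B = 0 := by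
    refine (Submodule.disjoint_def.1 (hb.disjoint h.symm_left)) B (fun w => ?_) (fun u v w => ?_)
    · refine ⟨LinearMap.mk ⟨fun u => A u w, fun x y => by simp⟩ (fun c x => by simp),
        ⟨fun u v => hskew u v w, fun u v z => ?_⟩, fun u v => rfl⟩
      change g (A u w) (Υ z v) + g u (Υ z (A v w)) + g u (Υ (A z w) v) = 0
      rw [hskew, hder, map_add]
      ring
    · change g u (A v w) = -g u (A w v)
      rw [hswap, map_neg]
  ext v w
  refine eq_of_forall_inner_eq hpos fun u => ?_
  have : g u (A v w) = B.1 u v w := rfl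
  rw [this, hB]
  simp

/-- The conditions of `IsSO3Tensor.eq_zero_of_skew`, tested on a basis. -/
lemma IsSO3Tensor.eq_zero_of_skew_of_basis (h : IsSO3Tensor g Υ) (hsymm : ∀ u v, g u v = g v u)
    (hpos : ∀ v, v ≠ 0 → 0 < g v v) (hdim : Module.finrank ℝ V = 5) {ι : Type*} [Fintype ι]
    (b : Module.Basis ι ℝ V) (A : V →L[ℝ] V →L[ℝ] V)
    (hskew : ∀ i j k, g (A (b i) (b k)) (b j) + g (b i) (A (b j) (b k)) = 0)
    (hswap : ∀ i j k, g (b k) (A (b i) (b j) + A (b j) (b i)) = 0)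
    (hder : ∀ i j k m, g (b m) (A (Υ (b i) (b j)) (b k) - Υ (A (b i) (b k)) (b j) -
      Υ (b i) (A (b j) (b k))) = 0) : A = 0 := by
  have hskew' : ∀ u v w, g (A u w) v + g u (A v w) = 0 :=
    trilinear_eq_zero_of_basis b
      (fun v w => ⟨fun x y => by simp only [map_add, add_apply]; ring, fun c x => by
        simp only [map_smul, smul_apply, smul_eq_mul]; ring⟩)
      (fun u w => ⟨fun x y => by simp only [map_add, add_apply]; ring, fun c x => by
        simp only [map_smul, smul_apply, smul_eq_mul]; ring⟩)
      (fun u v => ⟨fun x y => by simp only [map_add, add_apply]; ring, fun c x => by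
        simp only [map_smul, smul_apply, smul_eq_mul]; ring⟩) hskew
  have hswap' : ∀ u w z, g z (A u w + A w u) = 0 :=
    trilinear_eq_zero_of_basis b
      (fun v w => ⟨fun x y => by simp only [map_add, add_apply]; ring, fun c x => by
        simp only [map_smul, map_add, smul_apply, smul_eq_mul]; ring⟩)
      (fun u w => ⟨fun x y => by simp only [map_add, add_apply]; ring, fun c x => by
        simp only [map_smul, map_add, smul_apply, smul_eq_mul]; ring⟩)
      (fun u v => ⟨fun x y => by simp only [map_add, add_apply]; ring, fun c x => by
        simp only [map_smul, smul_apply, smul_eq_mul]⟩) hswap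
  have hder' : ∀ u v w, A (Υ u v) w - Υ (A u w) v - Υ u (A v w) = 0 :=
    trilinear_eq_zero_of_basis b
      (fun v w => ⟨fun x y => by simp only [map_add, add_apply]; module, fun c x => by
        simp only [map_smul, smul_apply]; module⟩)
      (fun u w => ⟨fun x y => by simp only [map_add, add_apply]; module, fun c x => by
        simp only [map_smul, smul_apply]; module⟩)
      (fun u v => ⟨fun x y => by simp only [map_add, add_apply]; module, fun c x => by
        simp only [map_smul, smul_apply]; module⟩)
      fun i j k => eq_of_forall_inner_basis_eq hpos b fun m => by rw [hder, map_zero]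
  refine h.eq_zero_of_skew hsymm hpos hdim A
    (fun u v w => eq_neg_of_add_eq_zero_left (hskew' u v w)) (fun u w => ?_) (fun u v w => ?_)
  · exact eq_neg_of_add_eq_zero_left (eq_of_forall_inner_eq hpos fun z => by
      rw [hswap', map_zero])
  · linear_combination (norm := module) hder' u v w

end Algebra

section Manifold

variable {E : Type*} [NormedAddCommGroup E] [NormedSpace ℝ E] [FiniteDimensional ℝ E]
  {H : Type*} [TopologicalSpace H] {I : ModelWithCorners ℝ E H}
  {M : Type*} [TopologicalSpace M] [ChartedSpace H M] [IsManifold I ∞ M]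
  {g : ContMDiffRiemannianMetric I ∞ E (TangentSpace I : M → Type _)}

instance (x : M) : T2Space (TangentSpace I x) := inferInstanceAs (T2Space E)

instance (x : M) : FiniteDimensional ℝ (TangentSpace I x) :=
  inferInstanceAs (FiniteDimensional ℝ E)

/-- Vector fields forming a basis at a given point. They are global, unlike those of a local frame,
so that a smooth connection can be applied to them. -/
lemma exists_contMDiff_frame [T2Space M] (x₀ : M) :
    ∃ (X : Fin (Module.finrank ℝ E) → ∀ x : M, TangentSpace I x)
      (b : Module.Basis (Fin (Module.finrank ℝ E)) ℝ (TangentSpace I x₀)),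
      (∀ i, CMDiff ∞ (T% (X i))) ∧ ∀ i, X i x₀ = b i := by
  let b : Module.Basis (Fin (Module.finrank ℝ E)) ℝ (TangentSpace I x₀) := Module.finBasis ℝ E
  choose X hX hX' using fun i =>
    exists_contMDiff_section (I := I) (F := E) (V := (TangentSpace I : M → Type _)) (b i)
  exact ⟨X, b, hX', hX⟩

lemma contMDiffAt_mlieBracket {X Y : ∀ x : M, TangentSpace I x} {x : M}
    (hX : CMDiffAt ∞ (T% X) x) (hY : CMDiffAt ∞ (T% Y) x) :
    CMDiffAt ∞ (T% (VectorField.mlieBracket I X Y)) x := by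
  have : CompleteSpace E := FiniteDimensional.complete ℝ E
  have : IsManifold I (((⊤ : ℕ∞) : ℕ∞ω) + 1) M := by
    have : (((⊤ : ℕ∞) : ℕ∞ω) + 1) = ∞ := rfl
    rw [this]; infer_instance
  have : IsManifold I (minSmoothness ℝ 2) M := by simpa using (inferInstance : IsManifold I 2 M)
  exact ContMDiffAt.mlieBracket_vectorField (m := ⊤) (n := ⊤) hX hY (by simp)

/-- The metric `g` serves only to read off the coefficients of the torsion in a frame. -/
lemma contMDiff_torsion [T2Space M]
    (g : ContMDiffRiemannianMetric I ∞ E (TangentSpace I : M → Type _))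
    {D : Connection I M} (hD : CovariantDerivative.ContMDiffCovariantDerivative D ∞) :
    ContMDiff I (I.prod 𝓘(ℝ, E →L[ℝ] E →L[ℝ] E)) ∞
      (fun x => TotalSpace.mk' (E →L[ℝ] E →L[ℝ] E)
        (E := fun x : M => TangentSpace I x →L[ℝ] TangentSpace I x →L[ℝ] TangentSpace I x)
        x (torsion D x)) := by
  intro x₀
  obtain ⟨X, b, hX, hXb⟩ := exists_contMDiff_frame (I := I) x₀
  have hXd : ∀ i x, MDiffAt (T% (X i)) x := fun i x =>
    (hX i).contMDiffAt.mdifferentiableAt (by simp)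
  refine contMDiffAt_section_of_functionals
    (V := fun x : M => TangentSpace I x →L[ℝ] TangentSpace I x →L[ℝ] TangentSpace I x)
    (J := Fin (Module.finrank ℝ E) × Fin (Module.finrank ℝ E) × Fin (Module.finrank ℝ E))
    (fun j x T => g.inner x (X j.2.2 x) (T (X j.1 x) (X j.2.1 x))) (fun j x => ?_)
    (fun j T hT => ?_) (fun T hT => ?_) _ (fun j => ?_)
  · exact ⟨fun T T' => by simp, fun c T => by simp⟩
  · exact contMDiffAt_inner (hX _).contMDiffAt (ContMDiffAt.clm_bundle_apply₂ (F₁ := E) (F₂ := E)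
      hT (hX _).contMDiffAt (hX _).contMDiffAt)
  · refine ContinuousLinearMap.coe_injective (b.ext fun i => ?_)
    refine ContinuousLinearMap.coe_injective (b.ext fun j => ?_)
    refine eq_of_forall_inner_basis_eq (g.pos x₀) b fun k => ?_
    have := hT (i, j, k)
    simp only [hXb] at this
    simpa using this
  · simp only [torsion_apply D (hXd _ _) (hXd _ _)]
    refine contMDiffAt_inner (hX _).contMDiffAt (ContMDiffAt.sub_section (ContMDiffAt.sub_section
      (contMDiffAt_connection_apply hD (hX _) (hX _) _)
      (contMDiffAt_connection_apply hD (hX _) (hX _) _))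
      (contMDiffAt_mlieBracket (hX _).contMDiffAt (hX _).contMDiffAt))

variable {S : SO3Structure g}

/-- The totally skew correction of a smooth metric connection that makes `Υ` parallel is smooth,
since it is determined pointwise by linear equations with smooth coefficients. -/
lemma SO3Structure.contMDiff_correction [T2Space M] (hE : Module.finrank ℝ E = 5)
    {D : Connection I M} (hD : CovariantDerivative.ContMDiffCovariantDerivative D ∞)
    {A : ∀ x : M, TangentSpace I x →L[ℝ] TangentSpace I x →L[ℝ] TangentSpace I x}
    (hskew : ∀ x u v w, g.inner x (A x u w) v = -g.inner x u (A x v w))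
    (hswap : ∀ x u w, A x u w = -A x w u)
    (hder : ∀ x w u v, S.covDeriv D x w u v + A x (S.tensor x u v) w - S.tensor x (A x u w) v -
      S.tensor x u (A x v w) = 0) :
    ContMDiff I (I.prod 𝓘(ℝ, E →L[ℝ] E →L[ℝ] E)) ∞
      (fun x => TotalSpace.mk' (E →L[ℝ] E →L[ℝ] E)
        (E := fun x : M => TangentSpace I x →L[ℝ] TangentSpace I x →L[ℝ] TangentSpace I x)
        x (A x)) := by
  intro x₀
  obtain ⟨X, b, hX, hXb⟩ := exists_contMDiff_frame (I := I) x₀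
  have hXd : ∀ i x, MDiffAt (T% (X i)) x := fun i x =>
    (hX i).contMDiffAt.mdifferentiableAt (by simp)
  have happ : ∀ {B : ∀ x : M, TangentSpace I x →L[ℝ] TangentSpace I x →L[ℝ] TangentSpace I x}
      {Y Z : ∀ x : M, TangentSpace I x}, ContMDiffAt I (I.prod 𝓘(ℝ, E →L[ℝ] E →L[ℝ] E)) ∞
      (fun x => TotalSpace.mk' (E →L[ℝ] E →L[ℝ] E)
        (E := fun x : M => TangentSpace I x →L[ℝ] TangentSpace I x →L[ℝ] TangentSpace I x)
        x (B x)) x₀ → CMDiffAt ∞ (T% Y) x₀ → CMDiffAt ∞ (T% Z) x₀ →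
      CMDiffAt ∞ (T% fun x => B x (Y x) (Z x)) x₀ := fun hB hY hZ =>
    ContMDiffAt.clm_bundle_apply₂ (F₁ := E) (F₂ := E) hB hY hZ
  have hXs : ∀ i, CMDiffAt ∞ (T% (X i)) x₀ := fun i => (hX i).contMDiffAt
  let F₃ := Fin (Module.finrank ℝ E) × Fin (Module.finrank ℝ E) × Fin (Module.finrank ℝ E)
  -- the three conditions on `A`, tested on a frame
  let l : (F₃ ⊕ F₃) ⊕ (F₃ × Fin (Module.finrank ℝ E)) → ∀ x : M,
      (TangentSpace I x →L[ℝ] TangentSpace I x →L[ℝ] TangentSpace I x) → ℝ :=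
    Sum.elim (Sum.elim
      (fun j x B => g.inner x (B (X j.1 x) (X j.2.2 x)) (X j.2.1 x) +
        g.inner x (X j.1 x) (B (X j.2.1 x) (X j.2.2 x)))
      (fun j x B => g.inner x (X j.2.2 x) (B (X j.1 x) (X j.2.1 x) + B (X j.2.1 x) (X j.1 x))))
      (fun j x B => g.inner x (X j.2 x) (B (S.tensor x (X j.1.1 x) (X j.1.2.1 x)) (X j.1.2.2 x) -
        S.tensor x (B (X j.1.1 x) (X j.1.2.2 x)) (X j.1.2.1 x) -
        S.tensor x (X j.1.1 x) (B (X j.1.2.1 x) (X j.1.2.2 x))))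
  refine contMDiffAt_section_of_functionals
    (V := fun x : M => TangentSpace I x →L[ℝ] TangentSpace I x →L[ℝ] TangentSpace I x)
    l ?_ ?_ (fun B hB => ?_) _ ?_
  · rintro ((j | j) | j) x <;> refine ⟨fun B B' => ?_, fun c B => ?_⟩ <;>
      simp only [l, Sum.elim_inl, Sum.elim_inr, map_add, map_sub, map_smul, add_apply, smul_apply,
        smul_eq_mul] <;> ring
  · rintro ((j | j) | j) B hB
    · exact (contMDiffAt_inner (happ hB (hXs _) (hXs _)) (hXs _)).add
        (contMDiffAt_inner (hXs _) (happ hB (hXs _) (hXs _)))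
    · exact contMDiffAt_inner (hXs _) (ContMDiffAt.add_section (happ hB (hXs _) (hXs _))
        (happ hB (hXs _) (hXs _)))
    · exact contMDiffAt_inner (hXs _) (ContMDiffAt.sub_section (ContMDiffAt.sub_section
        (happ hB (S.contMDiffAt_tensor (hXs _) (hXs _)) (hXs _))
        (S.contMDiffAt_tensor (happ hB (hXs _) (hXs _)) (hXs _)))
        (S.contMDiffAt_tensor (hXs _) (happ hB (hXs _) (hXs _))))
  · exact (S.isSO3Tensor x₀).eq_zero_of_skew_of_basis (g.symm x₀) (g.pos x₀) hE b B
      (fun i j k => by simpa only [l, Sum.elim_inl, hXb] using hB (Sum.inl (Sum.inl (i, j, k))))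
      (fun i j k => by
        simpa only [l, Sum.elim_inl, Sum.elim_inr, hXb] using hB (Sum.inl (Sum.inr (i, j, k))))
      (fun i j k m => by simpa only [l, Sum.elim_inr, hXb] using hB (Sum.inr ((i, j, k), m)))
  · rintro ((j | j) | j)
    · simp only [l, Sum.elim_inl, hskew, neg_add_cancel]
      exact contMDiffAt_const
    · simp only [l, Sum.elim_inl, Sum.elim_inr, hswap _ (X j.1 _), neg_add_cancel, map_zero]
      exact contMDiffAt_const
    · have h : ∀ x, l (Sum.inr j) x (A x) = g.inner x (X j.2 x)
          (S.tensor x (D (X j.1.1) x (X j.1.2.2 x)) (X j.1.2.1 x) +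
            S.tensor x (X j.1.1 x) (D (X j.1.2.1) x (X j.1.2.2 x)) -
            D (fun y => S.tensor y (X j.1.1 y) (X j.1.2.1 y)) x (X j.1.2.2 x)) := fun x => by
        have h1 := hder x (X j.1.2.2 x) (X j.1.1 x) (X j.1.2.1 x)
        rw [S.covDeriv_apply D _ (hXd _ _) (hXd _ _)] at h1
        simp only [l, Sum.elim_inr]
        congr 1
        linear_combination (norm := module) h1
      simp only [h]
      refine contMDiffAt_inner (hXs _) (ContMDiffAt.sub_section (ContMDiffAt.add_section
        (S.contMDiffAt_tensor (contMDiffAt_connection_apply hD (hX _) (hX _) _) (hXs _))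
        (S.contMDiffAt_tensor (hXs _) (contMDiffAt_connection_apply hD (hX _) (hX _) _)))
        (contMDiffAt_connection_apply hD (hX _)
          (fun x => S.contMDiffAt_tensor (hX _ x) (hX _ x)) _))

end Manifold

/-! ### Characteristic connections -/

section Main

variable {E : Type*} [NormedAddCommGroup E] [NormedSpace ℝ E] [FiniteDimensional ℝ E]
  {H : Type*} [TopologicalSpace H] {I : ModelWithCorners ℝ E H}
  {M : Type*} [TopologicalSpace M] [ChartedSpace H M] [IsManifold I ∞ M]
  {g : ContMDiffRiemannianMetric I ∞ E (TangentSpace I : M → Type _)} {S : SO3Structure g}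

namespace SO3Structure

lemma IsSO3Connection.covDeriv_eq_zero {D : Connection I M} (hD : S.IsSO3Connection D) {x : M}
    (w u v : TangentSpace I x) : S.covDeriv D x w u v = 0 := by
  refine eq_of_forall_inner_eq (g.pos x) fun z => ?_
  have hu := FiberBundle.mdifferentiableAt_extend I E u
  have hv := FiberBundle.mdifferentiableAt_extend I E v
  have hz := FiberBundle.mdifferentiableAt_extend I E z
  have h1 := S.tensorDeriv_eq hD.metric w hz hv hu
  rw [hD.parallel _ _ _ x w hz hv hu] at h1
  simp only [FiberBundle.extend_apply_self] at h1
  rw [← h1, map_zero]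

/-- For a characteristic connection `D` with torsion `T`, the Levi-Civita connection is `D + T / 2`,
and `T (v, v) = 0`. -/
lemma IsCharacteristic.isNearlyIntegrable [T2Space M] {D : Connection I M}
    (hD : S.IsCharacteristic D) : S.IsNearlyIntegrable := by
  have hT := contMDiff_torsion g hD.isSO3Connection.smooth
  refine ⟨D.addOneForm fun x => (1 / 2 : ℝ) • torsion D x, ⟨?_, ?_, fun x => ?_⟩,
    fun X x hX => ?_⟩
  · exact contMDiffCovariantDerivative_addOneForm hD.isSO3Connection.smooth
      (ContMDiff.const_smul_section hT)
  · refine isMetric_addOneForm hD.isSO3Connection.metric fun x u v w => ?_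
    have h1 := hD.torsion_swap_left x u w v
    have h2 := hD.torsion_swap_right x w u v
    have h3 := hD.torsion_swap_left x w v u
    simp only [smul_apply, map_smul, smul_eq_mul]
    rw [g.symm x u]
    linarith
  · ext u v
    rw [torsion_addOneForm]
    simp only [smul_apply, torsion_antisymm D v u]
    simp
    module
  · have h0 := hD.isSO3Connection.parallel X X X x (X x) hX hX hX
    rw [← h0]
    simp only [tensorDeriv, CovariantDerivative.addOneForm, add_apply, smul_apply, torsion_self,
      smul_zero, add_zero]

/-- The pointwise corrections of `IsAdapted.exists_correction` form a smooth tensor field `A`, and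
the connection corrected by `A` has torsion `-2 A`. -/
lemma IsNearlyIntegrable.exists_isCharacteristic [T2Space M] (hE : Module.finrank ℝ E = 5)
    (h : S.IsNearlyIntegrable) : ∃ D : Connection I M, S.IsCharacteristic D := by
  obtain ⟨D, hD, hni⟩ := h
  have key : ∀ x : M, ∃ A : TangentSpace I x →L[ℝ] TangentSpace I x →L[ℝ] TangentSpace I x,
      (∀ u v w, g.inner x (A u w) v = -g.inner x u (A v w)) ∧ (∀ u w, A u w = -A w u) ∧
      ∀ w u v, S.covDeriv D x w u v + A (S.tensor x u v) w - S.tensor x (A u w) v -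
        S.tensor x u (A v w) = 0 := fun x => by
    obtain ⟨b, hb⟩ := (S.isSO3Tensor x).exists_isAdapted (g.symm x) (g.pos x) hE
    obtain ⟨A, hA⟩ := hb.exists_correction (S.isSO3Tensor x).symm_left (g.pos x)
      (fun w => LinearMap.mk₂ ℝ (fun u v => S.covDeriv D x w u v) (by simp) (by simp) (by simp)
        (by simp)) (S.isLinearMap_covDeriv D) (fun w => S.covDeriv_comm w D)
      (fun w => S.covDeriv_symm w hD.metric) (fun w => S.covDeriv_tensor_self w hD.metric)
      (fun v => by
        have hv := FiberBundle.mdifferentiableAt_extend I E v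
        have h1 := S.tensorDeriv_eq hD.metric v hv hv hv
        have h2 := hni _ x hv
        simp only [FiberBundle.extend_apply_self] at h1 h2
        rw [h2] at h1
        exact h1.symm)
    exact ⟨LinearMap.toContinuousLinearMap (LinearMap.toContinuousLinearMap.toLinearMap ∘ₗ A), hA⟩
  choose A hskew hswap hder using key
  have hA := S.contMDiff_correction hE hD.smooth hskew hswap hder
  have hmet := isMetric_addOneForm hD.metric hskew
  refine ⟨D.addOneForm A, ⟨contMDiffCovariantDerivative_addOneForm hD.smooth hA, hmet,
    fun X Y Z x v hX hY hZ => ?_⟩, fun x u v w => ?_, fun x u v w => ?_⟩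
  · rw [S.tensorDeriv_eq hmet v hX hY hZ, S.covDeriv_addOneForm, hder, map_zero]
  · rw [torsion_antisymm, map_neg, neg_apply]
  · have h1 : ∀ u v, torsion (D.addOneForm A) x u v = (-2 : ℝ) • A x u v := fun u v => by
      rw [torsion_addOneForm, hD.torsion_free, hswap x v u]
      simp
      module
    rw [h1, h1, hswap x u v, g.symm x _ v]
    have h2 := hskew x v w u
    simp only [map_smul, smul_apply, smul_eq_mul, map_neg, neg_apply] at h2 ⊢
    rw [h2, hswap x w u, map_neg]
    ring

/-- The difference of two characteristic connections lies in `[so(3) ⊗ V] ∩ Λ³V = 0`. -/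
lemma IsCharacteristic.unique (hE : Module.finrank ℝ E = 5) {D D' : Connection I M}
    (hD : S.IsCharacteristic D) (hD' : S.IsCharacteristic D') {X : ∀ x : M, TangentSpace I x}
    {x : M} (hX : MDiffAt (T% X) x) : D X x = D' X x := by
  let A := D.isCovariantDerivativeOnUniv.difference D'.isCovariantDerivativeOnUniv
  have hA : ∀ {Y : ∀ x : M, TangentSpace I x}, MDiffAt (T% Y) x → A x (Y x) = D Y x - D' Y x :=
    fun hY => IsCovariantDerivativeOn.difference_apply _ _ (Set.mem_univ x) hY
  suffices h : A x = 0 by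
    rw [← sub_eq_zero, ← hA hX, h]
    simp
  have hext : ∀ u : TangentSpace I x, MDiffAt (T% (FiberBundle.extend E u)) x :=
    fun u => FiberBundle.mdifferentiableAt_extend I E u
  have hAe : ∀ u w : TangentSpace I x, A x u w =
      D (FiberBundle.extend E u) x w - D' (FiberBundle.extend E u) x w := fun u w => by
    have h := hA (hext u)
    rw [FiberBundle.extend_apply_self] at h
    rw [h, sub_apply]
  have hskew : ∀ u v w, g.inner x (A x u w) v = -g.inner x u (A x v w) := fun u v w => by
    have h1 := hD.isSO3Connection.metric _ _ x w (hext u) (hext v)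
    rw [hD'.isSO3Connection.metric _ _ x w (hext u) (hext v)] at h1
    simp only [FiberBundle.extend_apply_self] at h1
    rw [hAe, hAe, map_sub, map_sub, sub_apply]
    linarith
  have hder : ∀ u v w, A x (S.tensor x u v) w = S.tensor x (A x u w) v + S.tensor x u (A x v w) :=
    fun u v w => by
    have h1 := hA (S.mdifferentiableAt_tensor (hext u) (hext v))
    have h2 := S.covDeriv_apply D w (hext u) (hext v)
    have h3 := S.covDeriv_apply D' w (hext u) (hext v)
    rw [hD.isSO3Connection.covDeriv_eq_zero] at h2
    rw [hD'.isSO3Connection.covDeriv_eq_zero] at h3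
    simp only [FiberBundle.extend_apply_self] at h1 h2 h3
    rw [h1, hAe, hAe, map_sub, map_sub, sub_apply, sub_apply]
    linear_combination (norm := module) h3 - h2
  have htors : ∀ u v, torsion D x u v - torsion D' x u v = A x v u - A x u v := fun u v => by
    have h1 := torsion_apply D (hext u) (hext v)
    have h2 := torsion_apply D' (hext u) (hext v)
    simp only [FiberBundle.extend_apply_self] at h1 h2
    rw [h1, h2, hAe, hAe]
    module
  refine (S.isSO3Tensor x).eq_zero_of_skew (g.symm x) (g.pos x) hE (A x) hskew (fun v w => ?_) hder
  refine eq_of_forall_inner_eq (g.pos x) fun u => ?_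
  rw [map_neg]
  refine skew_of_torsion_skew (a := fun u v w => g.inner x u (A x v w))
    (fun u v w => by rw [g.symm x v, hskew, neg_neg]) (fun u v w => ?_) u v w
  simp only [← map_sub, ← htors]
  simp only [map_sub]
  have h1 := hD.torsion_swap_right x u v w
  have h2 := hD'.torsion_swap_right x u v w
  rw [g.symm x w, g.symm x w, g.symm x v, g.symm x v]
  linarith

end SO3Structure

end Main

end SO3Geometry

end

theorem mainTheorem4 {E : Type*} [NormedAddCommGroup E] [NormedSpace ℝ E] [FiniteDimensional ℝ E]
    (hE : Module.finrank ℝ E = 5)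
    {H : Type*} [TopologicalSpace H] {I : ModelWithCorners ℝ E H} [I.Boundaryless]
    {M : Type*} [TopologicalSpace M] [T2Space M] [SecondCountableTopology M]
    [ChartedSpace H M] [IsManifold I ∞ M]
    (g : ContMDiffRiemannianMetric I ∞ E (TangentSpace I : M → Type _))
    (S : SO3Geometry.SO3Structure g) :
    ((∃ D : SO3Geometry.Connection I M, S.IsCharacteristic D) ↔ S.IsNearlyIntegrable) ∧
    (∀ D D' : SO3Geometry.Connection I M, S.IsCharacteristic D → S.IsCharacteristic D' →
      ∀ (X : ∀ x : M, TangentSpace I x) (x : M), MDiffAt (T% X) x → D X x = D' X x) ∧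
    (∀ x : M,
      LinearMap.ker (SO3Geometry.upsilonPrime (S.tensor x)) =
        SO3Geometry.so3Tensor (g.inner x) (S.tensor x) ⊔
          SO3Geometry.lambdaThree (TangentSpace I x) ∧
      Disjoint (SO3Geometry.so3Tensor (g.inner x) (S.tensor x))
        (SO3Geometry.lambdaThree (TangentSpace I x))) := by
  refine ⟨⟨fun ⟨D, hD⟩ => hD.isNearlyIntegrable, fun h => h.exists_isCharacteristic hE⟩,
    fun D D' hD hD' X x hX => hD.unique hE hD' hX, fun x => ?_⟩
  have h := S.isSO3Tensor x
  obtain ⟨b, hb⟩ := h.exists_isAdapted (g.symm x) (g.pos x) hE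
  exact ⟨le_antisymm (hb.ker_le h.symm_left)
    (SO3Geometry.sup_le_ker (h.comm (g.pos x)) h.symm_left (g.symm x)),
    hb.disjoint h.symm_left⟩
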